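/- Let $(\Omega,\mathfrak F,\mathsf P)$ be a probability space, $\Lambda$ a measurable space (for instance a subset of $\mathbb R$ with some $\sigma$-algebra), and let $\xi(t)$, $t\in\mathbb R$, be a centered complex second order process with covariance $$B(t,s)=\mathsf E\,\xi(t)\overline{\xi(s)}=\int_\Lambda\int_\Lambda f(t,\lambda)\overline{f(s,\mu)}\,F_\xi(d\lambda,d\mu),\qquad t,s\in\mathbb R,$$ where $F_\xi$ is a positive definite complex measure on $\Lambda\times\Lambda$ of finite total variation $\|F_\xi\|=\int_\Lambda\int_\Lambda|F_\xi(d\lambda,d\mu)|$, $f(t,\cdot)$ is measurable for every real $t$, and for each $\lambda$ the function $f(\cdot,\lambda)$ is entire with $|f(z,\lambda)|\le Me^{\alpha|z|}$ for some $M>0$, $\alpha\in\mathbb R$ (a Piranashvili process). Let $$\gamma=\sup_{\lambda}\limsup_n|f^{(n)}(0,\lambda)|^{1/n}<w<\infty,\qquad \widetilde L_f=\sup_{t\in\mathbb R}\sup_{\lambda\in\Lambda}|f(t,\lambda)|<\infty .$$ Assume $B\in C^2(\mathbb R^2)$ and $\sup_{\mathbb R}|B''(t,t)|<\infty$, where $B''(t,t)=\frac{\partial^2B(r,s)}{\partial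 r\,\partial s}\big|_{r=s=t}$. Let $p>1$, $\frac1p+\frac1q=1$. For $N\ge1$ and $t\in\mathbb R$ put $\mathbb I_N(t)=\{n\in\mathbb Z:|wt/\pi-n|\le N\}$. For $n\in\mathbb I_N(t)$ let $\sigma_n'(t),\sigma_n''(t)\ge0$, let $\mathfrak J_n(t)=[n\pi/w-\sigma_n'(t),\,n\pi/w+\sigma_n''(t)]$, and let $u_n\ge0$ be a weight with $\int_{\mathfrak J_n(t)}u_n(x)\,dx=1$; the numbers $\sigma_n',\sigma_n''$ and the weights may depend on $N$ and $t$. Assume $\sigma=\sigma_N=\sup_{t\in\mathbb R}\max_{n\in\mathbb I_N(t)}\max(\sigma_n'(t),\sigma_n''(t))<\infty$ for each $N\ge 1$. Then the local averages $\langle\xi,u_n\rangle_{\mathfrak J_n(t)}=\int_{\mathfrak J_n(t)}\xi(x)u_n(x)\,dx$ exist as mean square integrals. Let $$\mathcal A_{\mathbf u,N}(\xi;t)=\sum_{n\in\mathbb I_N(t)}\langle\xi,u_n\rangle_{\mathfrak J_n(t)}\,\frac{\sin(wt-n\pi)}{wt-n\pi},$$ where $\frac{\sin 0}{0}$ is read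 as $1$. For all $N\ge1$ and $t\in\mathbb R$, $$\mathsf E\big|\xi(t)-\mathcal A_{\mathbf u,N}(\xi;t)\big|^2\le\frac{2\widetilde L_0(t)^2}{N^2}\,\|F_\xi\|+2\sigma^2\,\mathsf C_q(t)\,\sup_{s\in\mathbb R}|B''(s,s)|\,(2N+1)^{2/p},$$ where $$\widetilde L_0(t)=\frac{4\widetilde L_f\,w\,|\sin(wt)|}{\pi(w-\gamma)(1-e^{-\pi})},\qquad \mathsf C_q(t)=\Big(1+\frac{2^{q+1}|\sin(wt)|^q}{\pi^q}\sum_{n=1}^\infty\frac1{(2n-1)^q}\Big)^{2/q}.$$ If $\sigma_N=o(N^{-1/p})$ as $N\to\infty$, then $\mathcal A_{\mathbf u,N}(\xi;t)\to\xi(t)$ in mean square for every $t\in\mathbb R$. If $\sigma_N=O(N^{-1/2-1/p-\varepsilon})$ for some $\varepsilon>0$, then $\mathsf P\{\lim_{N\to\infty}\mathcal A_{\mathbf u,N}(\xi;t)=\xi(t)\}=1$ for every $t\in\mathbb R$. -/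

import Mathlib

open Filter Set MeasureTheory Asymptotics

noncomputable section

namespace AverageSampling

/-- The covariance function `B(t, s) = E[ξ(t) ξ(s)*]` of a centered complex process. -/
def cov {Ω : Type*} [MeasurableSpace Ω] (P : Measure Ω) (ξ : ℝ → Ω → ℂ) (t s : ℝ) : ℂ :=
  ∫ ω, ξ t ω * starRingEnd ℂ (ξ s ω) ∂P

/-- The mixed second derivative `∂²B(r, s)/∂r∂s` on the diagonal `r = s = t`. -/
def diagDeriv (B : ℝ → ℝ → ℂ) (t : ℝ) : ℂ :=
  deriv (fun r => deriv (fun s => B r s) t) t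

/-- `F` is positive definite: `∑ᵢⱼ cᵢ cⱼ* F(Sᵢ × Sⱼ)` is a nonnegative real number. -/
def IsPosDef {Λ : Type*} [MeasurableSpace Λ] (F : ComplexMeasure (Λ × Λ)) : Prop :=
  ∀ (m : ℕ) (S : Fin m → Set Λ) (c : Fin m → ℂ), (∀ i, MeasurableSet (S i)) →
    0 ≤ (∑ i, ∑ j, c i * starRingEnd ℂ (c j) * F (S i ×ˢ S j)).re ∧
      (∑ i, ∑ j, c i * starRingEnd ℂ (c j) * F (S i ×ˢ S j)).im = 0

/-- `ξ` is a Piranashvili process on the probability space `(Ω, P)` with kernel `f` and spectral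
measure `F` on `Λ × Λ`. The kernel is given directly through its extension to the complex plane
in the first argument. -/
structure IsPiranashvili {Ω Λ : Type*} [MeasurableSpace Ω] [MeasurableSpace Λ] (P : Measure Ω)
    (ξ : ℝ → Ω → ℂ) (f : ℂ → Λ → ℂ) (F : ComplexMeasure (Λ × Λ)) : Prop where
  memLp : ∀ t, MemLp (ξ t) 2 P
  centered : ∀ t, ∫ ω, ξ t ω ∂P = 0
  entire : ∀ l, Differentiable ℂ (fun z => f z l)
  exp_bounded : ∀ l, ∃ M α : ℝ, 0 < M ∧ ∀ z, ‖f z l‖ ≤ M * Real.exp (α * ‖z‖)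
  measurable : ∀ t : ℝ, Measurable (f (t : ℂ))
  posDef : IsPosDef F
  finite_variation : F.variation univ < ⊤
  integrable : ∀ t s : ℝ,
    F.Integrable (fun x => f (t : ℂ) x.1 * starRingEnd ℂ (f (s : ℂ) x.2))
  cov_eq : ∀ t s : ℝ, cov P ξ t s =
    F.integral (fun x => f (t : ℂ) x.1 * starRingEnd ℂ (f (s : ℂ) x.2))
      (ContinuousLinearMap.mul ℝ ℂ)

/-- `γ = sup_λ limsup_n |f⁽ⁿ⁾(0, λ)|^{1/n}`. -/
def expType {Λ : Type*} (f : ℂ → Λ → ℂ) : ENNReal :=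
  ⨆ l, limsup (fun n : ℕ => ‖iteratedDeriv n (fun z => f z l) 0‖ₑ ^ (1 / (n : ℝ))) atTop

/-- `sup_{t ∈ ℝ} sup_{λ ∈ Λ} |f(t, λ)|`. -/
def kernelSup {Λ : Type*} (f : ℂ → Λ → ℂ) : ℝ :=
  ⨆ x : ℝ × Λ, ‖f (x.1 : ℂ) x.2‖

/-- The factor `4 L w |sin(w t)| / (π (w - γ) (1 - e^{-π}))`. -/
def truncFactor {Λ : Type*} (f : ℂ → Λ → ℂ) (w t : ℝ) : ℝ :=
  4 * kernelSup f * w * |Real.sin (w * t)| /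
    (Real.pi * (w - (expType f).toReal) * (1 - Real.exp (-Real.pi)))

/-- The Dirichlet lambda function `∑_{n ≥ 1} (2n - 1)^{-q}`. -/
def dirichletLambda (q : ℝ) : ℝ := ∑' n : ℕ, 1 / (2 * (n : ℝ) + 1) ^ q

/-- `C_q(t) = (1 + 2^{q+1} |sin(w t)|^q / π^q · λ(q))^{2/q}`. -/
def sincFactor (q w t : ℝ) : ℝ :=
  (1 + 2 ^ (q + 1) * |Real.sin (w * t)| ^ q / Real.pi ^ q * dirichletLambda q) ^ (2 / q)

/-- The time shifted index set `{n ∈ ℤ : |w t / π - n| ≤ N}`. -/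
def indexSet (w : ℝ) (N : ℕ) (t : ℝ) : Finset ℤ :=
  Finset.Icc ⌈w * t / Real.pi - N⌉ ⌊w * t / Real.pi + N⌋

theorem mem_indexSet {w : ℝ} {N : ℕ} {t : ℝ} {n : ℤ} :
    n ∈ indexSet w N t ↔ |w * t / Real.pi - n| ≤ N := by
  rw [indexSet, Finset.mem_Icc, Int.ceil_le, Int.le_floor, abs_le]
  constructor <;> rintro ⟨h₁, h₂⟩ <;> constructor <;> linarith

/-- The averaging interval around the sampling point `n π / w`, with left half-length `a` and
right half-length `b`. -/
def avgInterval (w : ℝ) (n : ℤ) (a b : ℝ) : Set ℝ :=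
  Icc (n * Real.pi / w - a) (n * Real.pi / w + b)

/-- All the half-lengths `max(a(t, n), b(t, n))` with `t ∈ ℝ` and `|w t / π - n| ≤ N`. -/
def halfLengths (w : ℝ) (N : ℕ) (a b : ℝ → ℤ → ℝ) : Set ℝ :=
  {r | ∃ t : ℝ, ∃ n ∈ indexSet w N t, r = max (a t n) (b t n)}

/-- `σ`, the supremum of all the half-lengths. -/
def sigma (w : ℝ) (N : ℕ) (a b : ℝ → ℤ → ℝ) : ℝ := sSup (halfLengths w N a b)

/-- Admissible data for the average sampling sum with `N` fixed: half-lengths that are nonnegative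
and uniformly bounded, and nonnegative weights of integral one on the averaging intervals. -/
structure IsAveragingScheme (w : ℝ) (N : ℕ) (a b : ℝ → ℤ → ℝ) (u : ℝ → ℤ → ℝ → ℝ) : Prop where
  left_nonneg : ∀ t, ∀ n ∈ indexSet w N t, 0 ≤ a t n
  right_nonneg : ∀ t, ∀ n ∈ indexSet w N t, 0 ≤ b t n
  bounded : BddAbove (halfLengths w N a b)
  weight_nonneg : ∀ t, ∀ n ∈ indexSet w N t, ∀ x ∈ avgInterval w n (a t n) (b t n), 0 ≤ u t n x
  weight_normalized : ∀ t, ∀ n ∈ indexSet w N t,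
    ∫ x in avgInterval w n (a t n) (b t n), u t n x = 1

/-- The local average `∫_J ξ(x) v(x) dx`, as a mean square (Bochner) integral in `L²(P)`. -/
def localAverage {Ω : Type*} [MeasurableSpace Ω] {P : Measure Ω} {ξ : ℝ → Ω → ℂ}
    (hξ : ∀ t, MemLp (ξ t) 2 P) (J : Set ℝ) (v : ℝ → ℝ) : Lp ℂ 2 P :=
  ∫ x in J, v x • (hξ x).toLp (ξ x)

/-- The time shifted average sampling sum; `Real.sinc x` is `sin x / x`, and `1` at `x = 0`. -/
def averageSum {Ω : Type*} [MeasurableSpace Ω] {P : Measure Ω} {ξ : ℝ → Ω → ℂ}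
    (hξ : ∀ t, MemLp (ξ t) 2 P) (w : ℝ) (N : ℕ) (a b : ℝ → ℤ → ℝ) (u : ℝ → ℤ → ℝ → ℝ)
    (t : ℝ) : Lp ℂ 2 P :=
  ∑ n ∈ indexSet w N t, Real.sinc (w * t - n * Real.pi) •
    localAverage hξ (avgInterval w n (a t n) (b t n)) (u t n)

/-- The mean square error `E|X - Y|²`. -/
def meanSquareError {Ω : Type*} [MeasurableSpace Ω] (P : Measure Ω) (X Y : Ω → ℂ) : ℝ :=
  ∫ ω, ‖X ω - Y ω‖ ^ 2 ∂P

end AverageSampling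

end

noncomputable section

namespace AverageSampling

open scoped Topology

/-! ### Entire functions of exponential type bounded on the real line -/

/-! Between `ξ t` and the average sum stands `samplingSum`, the same truncated sinc series with
point values in place of local averages. Since `(x + y)² ≤ 2x² + 2y²`, the error is at most twice
the squared truncation error plus twice the squared averaging error, both measured in `L²(P)`.

Truncation. The spectral formula for the covariance turns the squared norm of a finite combination
of values of `ξ` into a double integral of the same combination of kernels. This is at most the
squared supremum of that combination times the total variation (`norm_sq_sum_toLp_le`), so a
deterministic estimate, uniform in `λ`, suffices. By Phragmén–Lindelöf, each kernel is bounded by `L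
exp(γ |Im z|)`. The function `g z / ((z - t) sin (w z))` has residues which, multiplied by `sin (w
t)`, sum to exactly the truncation error. On vertical lines midway between nodes it decays like
`exp(-(w - γ)|y|)`, with a constant inversely proportional to the distance from `t`. That distance
is of order `N`, which gives the factor `1/N` (`norm_sub_sum_sinc_le`).

Averaging. A second difference of the covariance controls `‖ξ z - ξ s‖²`. Hence the bound `M` on its
mixed derivative along the diagonal makes `t ↦ ξ t` Lipschitz in `L²` with constant `√M`
(`norm_toLp_sub_le`). A local average then differs from the value at its node by at most `√M σ`, and
Hölder's inequality bounds the sum of the sinc weights (`sq_sum_abs_sinc_le`).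

The bound tends to zero under the first rate for `σ`. Under the second it is summable in `N`, which
forces almost sure convergence. -/

theorem exists_norm_iteratedDeriv_le {g : ℂ → ℂ} {r : ℝ} (hr : 0 < r)
    (h : limsup (fun n : ℕ => ‖iteratedDeriv n g 0‖ₑ ^ (1 / (n : ℝ))) atTop < ENNReal.ofReal r) :
    ∃ C : ℝ, ∀ n : ℕ, ‖iteratedDeriv n g 0‖ ≤ C * r ^ n := by
  have hO : (fun n : ℕ => iteratedDeriv n g 0) =O[atTop] (fun n : ℕ => r ^ n) := by
    refine IsBigO.of_bound 1 ?_
    filter_upwards [eventually_lt_of_limsup_lt h, eventually_gt_atTop 0] with n hn hn0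
    have hn' : (0 : ℝ) < n := by exact_mod_cast hn0
    have h1 : ‖iteratedDeriv n g 0‖ₑ ≤ ENNReal.ofReal r ^ (n : ℝ) := by
      have := ENNReal.rpow_le_rpow hn.le hn'.le
      rwa [← ENNReal.rpow_mul, one_div_mul_cancel hn'.ne', ENNReal.rpow_one] at this
    rw [ENNReal.rpow_natCast, ← ENNReal.ofReal_pow hr.le, ← ofReal_norm,
      ENNReal.ofReal_le_ofReal_iff (by positivity)] at h1
    rwa [one_mul, Real.norm_of_nonneg (by positivity)]
  -- Since `r ^ n` never vanishes, a larger constant absorbs the finitely many exceptional `n`.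
  rw [isBigO_nat_atTop_iff (fun n hn => absurd hn (by positivity))] at hO
  obtain ⟨C, hC⟩ := hO
  refine ⟨C, fun n => (hC n).trans_eq ?_⟩
  rw [Real.norm_of_nonneg (by positivity)]

theorem norm_le_exp_of_iteratedDeriv_le {g : ℂ → ℂ} (hg : Differentiable ℂ g) {r C : ℝ}
    (h : ∀ n : ℕ, ‖iteratedDeriv n g 0‖ ≤ C * r ^ n) (z : ℂ) :
    ‖g z‖ ≤ C * Real.exp (r * ‖z‖) := by
  have h1 := Complex.hasSum_taylorSeries_of_entire hg 0 z
  have h2 : HasSum (fun n : ℕ => C * ((r * ‖z‖) ^ n / n.factorial)) (C * Real.exp (r * ‖z‖)) := by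
    rw [Real.exp_eq_exp_ℝ]
    exact (NormedSpace.expSeries_div_hasSum_exp (r * ‖z‖)).mul_left C
  rw [← h1.tsum_eq]
  refine tsum_of_norm_bounded h2 fun n => ?_
  rw [norm_smul, norm_smul, norm_inv, Complex.norm_natCast, norm_pow, sub_zero, mul_pow]
  calc (n.factorial : ℝ)⁻¹ * (‖z‖ ^ n * ‖iteratedDeriv n g 0‖)
      ≤ (n.factorial : ℝ)⁻¹ * (‖z‖ ^ n * (C * r ^ n)) := by gcongr; exact h n
    _ = _ := by ring

/-- The factor `exp(-r ζ)` has modulus one on the imaginary axis and cancels the growth on the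
positive real axis. Phragmén–Lindelöf in the right half-plane then replaces the growth constant `C`
by the boundary constant `L`. -/
theorem norm_le_exp_re_of_bounded_on_imaginary {g : ℂ → ℂ} (hg : Differentiable ℂ g) {r C L : ℝ}
    (hr : 0 ≤ r) (hexp : ∀ z, ‖g z‖ ≤ C * Real.exp (r * ‖z‖))
    (him : ∀ x : ℝ, ‖g (x * Complex.I)‖ ≤ L) {z : ℂ} (hz : 0 ≤ z.re) :
    ‖g z‖ ≤ L * Real.exp (r * z.re) := by
  have hnorm (ζ : ℂ) : ‖g ζ * Complex.exp (-r * ζ)‖ = ‖g ζ‖ * Real.exp (-(r * ζ.re)) := by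
    rw [norm_mul, Complex.norm_exp]; simp
  have key : ‖g z * Complex.exp (-r * z)‖ ≤ L := by
    refine PhragmenLindelof.right_half_plane_of_bounded_on_real (C := L)
      (f := fun ζ => g ζ * Complex.exp (-r * ζ)) ?_ ⟨1, by norm_num, r, ?_⟩ ?_ ?_ hz
    · exact (hg.mul (by fun_prop)).diffContOnCl
    · refine IsBigO.of_bound C ?_
      refine eventually_inf_principal.2 (Eventually.of_forall fun ζ hζ => ?_)
      have hζ : 0 < ζ.re := hζ
      simp only [Real.rpow_one]
      rw [hnorm, Real.norm_of_nonneg (Real.exp_pos _).le]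
      refine le_trans ?_ (hexp ζ)
      exact mul_le_of_le_one_right (norm_nonneg _) (Real.exp_le_one_iff.2 (by nlinarith))
    · refine isBoundedUnder_of_eventually_le (a := C) ?_
      filter_upwards [eventually_ge_atTop 0] with x hx
      have h1 := hexp x
      rw [hnorm, Complex.ofReal_re, Real.exp_neg, ← div_eq_mul_inv, div_le_iff₀ (Real.exp_pos _)]
      rwa [Complex.norm_real, Real.norm_of_nonneg hx] at h1
    · intro x
      rw [hnorm]; simpa using him x
  rw [hnorm, Real.exp_neg, ← div_eq_mul_inv, div_le_iff₀ (Real.exp_pos _)] at key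
  exact key

/-- Multiplication by `±I` carries the right half-plane to the upper or lower one and the imaginary
axis to the real line. -/
theorem norm_le_exp_im_of_bounded_on_real {g : ℂ → ℂ} (hg : Differentiable ℂ g) {r C L : ℝ}
    (hr : 0 ≤ r) (hexp : ∀ z, ‖g z‖ ≤ C * Real.exp (r * ‖z‖))
    (hre : ∀ x : ℝ, ‖g x‖ ≤ L) (z : ℂ) :
    ‖g z‖ ≤ L * Real.exp (r * |z.im|) := by
  have aux (ε : ℂ) (hε : ‖ε‖ = 1) (hεI : ∃ s : ℝ, ε * Complex.I = s) (ζ : ℂ) (hζ : 0 ≤ ζ.re) :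
      ‖g (ε * ζ)‖ ≤ L * Real.exp (r * ζ.re) := by
    refine norm_le_exp_re_of_bounded_on_imaginary (g := fun ζ => g (ε * ζ)) (C := C)
      (by fun_prop) hr (fun z => ?_) (fun x => ?_) hζ
    · simpa [hε] using hexp (ε * z)
    · obtain ⟨s, hs⟩ := hεI
      have : ε * (x * Complex.I) = ((s * x : ℝ) : ℂ) := by push_cast; rw [← hs]; ring
      rw [this]; exact hre _
  rcases le_total 0 z.im with h | h
  · have := aux Complex.I (by simp) ⟨-1, by simp⟩ (-Complex.I * z) (by simpa using h)
    rw [← mul_assoc] at this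
    simpa [abs_of_nonneg h] using this
  · have := aux (-Complex.I) (by simp) ⟨1, by simp⟩ (Complex.I * z) (by simpa using h)
    rw [← mul_assoc] at this
    simpa [abs_of_nonpos h] using this

/-- An entire function bounded by `L` on the real line and of exponential type `γ` satisfies
`‖g (x + i y)‖ ≤ L exp (γ |y|)`. -/
theorem norm_le_exp_type {g : ℂ → ℂ} (hg : Differentiable ℂ g) {L : ℝ} {γ : ENNReal}
    (hγ : γ ≠ ⊤)
    (h : limsup (fun n : ℕ => ‖iteratedDeriv n g 0‖ₑ ^ (1 / (n : ℝ))) atTop ≤ γ)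
    (hre : ∀ x : ℝ, ‖g x‖ ≤ L) (z : ℂ) :
    ‖g z‖ ≤ L * Real.exp (γ.toReal * |z.im|) := by
  -- The limsup gives coefficient bounds only for `r` strictly above the type, but `L` does not
  -- depend on `r`, so `r` may decrease to the type.
  have hlim : Tendsto (fun r : ℝ => L * Real.exp (r * |z.im|)) (𝓝[>] γ.toReal)
      (𝓝 (L * Real.exp (γ.toReal * |z.im|))) := by
    refine Tendsto.mono_left (Continuous.tendsto ?_ _) nhdsWithin_le_nhds
    fun_prop
  refine ge_of_tendsto hlim ?_
  filter_upwards [self_mem_nhdsWithin] with r hr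
  have hr : γ.toReal < r := hr
  have hr0 : 0 < r := ENNReal.toReal_nonneg.trans_lt hr
  obtain ⟨C, hC⟩ := exists_norm_iteratedDeriv_le (g := g) hr0
    (h.trans_lt ((ENNReal.lt_ofReal_iff_toReal_lt hγ).2 hr))
  exact norm_le_exp_im_of_bounded_on_real hg hr0.le (norm_le_exp_of_iteratedDeriv_le hg hC) hre z

/-! ### Residues at simple poles on the real line -/

/-- The integral of `h` along the boundary of the rectangle `[a, b] × [-Y, Y]`. -/
def rectIntegral (h : ℂ → ℂ) (a b Y : ℝ) : ℂ :=
  (∫ x : ℝ in a..b, h (x + (-Y : ℝ) * Complex.I)) - (∫ x : ℝ in a..b, h (x + Y * Complex.I)) +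
    Complex.I * (∫ y : ℝ in (-Y)..Y, h (b + y * Complex.I)) -
    Complex.I * ∫ y : ℝ in (-Y)..Y, h (a + y * Complex.I)

/-- Continuity at every point of the boundaries of the rectangles `[a, b] × [-Y, Y]`. -/
def ContinuousAtBoundary (h : ℂ → ℂ) (a b : ℝ) : Prop :=
  ∀ z : ℂ, z.re ∈ Icc a b → z.im ≠ 0 ∨ z.re = a ∨ z.re = b → ContinuousAt h z

variable {h k : ℂ → ℂ} {a b Y : ℝ}

theorem ContinuousAtBoundary.intervalIntegrable_horizontal (hh : ContinuousAtBoundary h a b)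
    (hab : a ≤ b) {y : ℝ} (hy : y ≠ 0) :
    IntervalIntegrable (fun x : ℝ => h (x + y * Complex.I)) volume a b := by
  refine ContinuousOn.intervalIntegrable fun x hx => ?_
  rw [uIcc_of_le hab] at hx
  have h1 : ContinuousAt h (x + y * Complex.I) := hh _ (by simpa using hx) (by simp [hy])
  exact (ContinuousAt.comp (f := fun x : ℝ => (x + y * Complex.I : ℂ)) h1
    (by fun_prop)).continuousWithinAt

theorem ContinuousAtBoundary.intervalIntegrable_vertical (hh : ContinuousAtBoundary h a b)
    {x : ℝ} (hx : x ∈ Icc a b) (hx' : x = a ∨ x = b) (Y : ℝ) :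
    IntervalIntegrable (fun y : ℝ => h (x + y * Complex.I)) volume (-Y) Y := by
  refine ContinuousOn.intervalIntegrable fun y _ => ?_
  have h1 : ContinuousAt h (x + y * Complex.I) := hh _ (by simpa using hx) (by simp [hx'])
  exact (ContinuousAt.comp (f := fun y : ℝ => (x + y * Complex.I : ℂ)) h1
    (by fun_prop)).continuousWithinAt

theorem rectIntegral_sub (hab : a ≤ b) (hY : 0 < Y) (hh : ContinuousAtBoundary h a b)
    (hk : ContinuousAtBoundary k a b) :
    rectIntegral (fun z => h z - k z) a b Y = rectIntegral h a b Y - rectIntegral k a b Y := by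
  simp only [rectIntegral]
  rw [intervalIntegral.integral_sub (hh.intervalIntegrable_horizontal hab (by linarith))
      (hk.intervalIntegrable_horizontal hab (by linarith)),
    intervalIntegral.integral_sub (hh.intervalIntegrable_horizontal hab hY.ne')
      (hk.intervalIntegrable_horizontal hab hY.ne'),
    intervalIntegral.integral_sub
      (hh.intervalIntegrable_vertical (right_mem_Icc.2 hab) (.inr rfl) Y)
      (hk.intervalIntegrable_vertical (right_mem_Icc.2 hab) (.inr rfl) Y),
    intervalIntegral.integral_sub
      (hh.intervalIntegrable_vertical (left_mem_Icc.2 hab) (.inl rfl) Y)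
      (hk.intervalIntegrable_vertical (left_mem_Icc.2 hab) (.inl rfl) Y)]
  ring

theorem rectIntegral_sum {ι : Type*} {s : Finset ι} (c : ι → ℂ) {k : ι → ℂ → ℂ} (hab : a ≤ b)
    (hY : 0 < Y) (hk : ∀ i ∈ s, ContinuousAtBoundary (k i) a b) :
    rectIntegral (fun z => ∑ i ∈ s, c i * k i z) a b Y =
      ∑ i ∈ s, c i * rectIntegral (k i) a b Y := by
  simp only [rectIntegral]
  rw [intervalIntegral.integral_finsetSum fun i hi =>
      ((hk i hi).intervalIntegrable_horizontal hab (by linarith)).const_mul _,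
    intervalIntegral.integral_finsetSum fun i hi =>
      ((hk i hi).intervalIntegrable_horizontal hab hY.ne').const_mul _,
    intervalIntegral.integral_finsetSum fun i hi =>
      ((hk i hi).intervalIntegrable_vertical (right_mem_Icc.2 hab) (.inr rfl) Y).const_mul _,
    intervalIntegral.integral_finsetSum fun i hi =>
      ((hk i hi).intervalIntegrable_vertical (left_mem_Icc.2 hab) (.inl rfl) Y).const_mul _]
  simp only [intervalIntegral.integral_const_mul, Finset.mul_sum, ← Finset.sum_sub_distrib,
    ← Finset.sum_add_distrib]
  refine Finset.sum_congr rfl fun i _ => by ring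

theorem continuousAtBoundary_sub_inv {p : ℝ} (hp : p ∈ Ioo a b) :
    ContinuousAtBoundary (fun z => (z - p)⁻¹) a b := by
  intro z _ hz'
  have : z - p ≠ 0 := by
    intro h0
    rw [sub_eq_zero] at h0
    subst h0
    simp only [Complex.ofReal_im, Complex.ofReal_re, ne_eq, not_true_eq_false, false_or] at hz'
    rcases hz' with h | h <;> linarith [hp.1, hp.2]
  fun_prop (disch := assumption)

/-- The boundary integral of a function with removable singularities at finitely many real points
vanishes. -/
theorem rectIntegral_eq_zero (hab : a < b) (hY : 0 < Y) {S : Finset ℝ} (hS : ∀ p ∈ S, p ∈ Ioo a b)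
    (hd : ∀ z : ℂ, z.re ∈ Icc a b → (∀ p ∈ S, z ≠ (p : ℂ)) → DifferentiableAt ℂ h z)
    (hlim : ∀ p ∈ S, Tendsto (fun z : ℂ => (z - p) * h z) (𝓝[≠] (p : ℂ)) (𝓝 0)) :
    rectIntegral h a b Y = 0 := by
  classical
  set T : Finset ℂ := S.image (fun p : ℝ => (p : ℂ)) with hT
  have hmemT (z : ℂ) : z ∉ T ↔ ∀ p ∈ S, z ≠ (p : ℂ) := by
    simp only [hT, Finset.mem_image, not_exists, not_and, ne_eq]
    exact forall₂_congr fun p _ => not_congr eq_comm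
  have hTev (z : ℂ) : ∀ᶠ ζ in 𝓝[≠] z, ζ ∉ T := by
    have : ((T.erase z : Finset ℂ) : Set ℂ)ᶜ ∈ 𝓝 z :=
      (T.erase z).finite_toSet.isClosed.isOpen_compl.mem_nhds (by simp)
    filter_upwards [nhdsWithin_le_nhds this, self_mem_nhdsWithin] with ζ h1 h2 h3
    exact h1 (Finset.mem_coe.2 (Finset.mem_erase.2 ⟨h2, h3⟩))
  -- Filling the singularities with limits makes `g` continuous on the closed strip, as Cauchy's
  -- theorem with countably many exceptional points requires. The boundary values do not change.
  set g : ℂ → ℂ := fun z => if z ∈ T then limUnder (𝓝[≠] z) h else h z with hg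
  have hgh (z : ℂ) (hz : z ∉ T) : g z = h z := if_neg hz
  have hgev (z : ℂ) (hz : z ∉ T) : g =ᶠ[𝓝 z] h := by
    filter_upwards [T.finite_toSet.isClosed.isOpen_compl.mem_nhds (by simpa using hz)] with ζ hζ
    exact hgh ζ (by simpa using hζ)
  have hgd (z : ℂ) (hz : z.re ∈ Icc a b) (hzT : z ∉ T) : DifferentiableAt ℂ g z :=
    (hgev z hzT).differentiableAt_iff.2 (hd z hz ((hmemT z).1 hzT))
  have hgc (z : ℂ) (hz : z.re ∈ Icc a b) : ContinuousAt g z := by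
    by_cases hzT : z ∈ T
    · obtain ⟨p, hp, rfl⟩ := Finset.mem_image.1 hzT
      have hdev : ∀ᶠ ζ in 𝓝[≠] (p : ℂ), DifferentiableAt ℂ h ζ := by
        have h1 : ∀ᶠ ζ : ℂ in 𝓝 (p : ℂ), ζ.re ∈ Ioo a b :=
          Complex.continuous_re.continuousAt.eventually (Ioo_mem_nhds (hS p hp).1 (hS p hp).2)
        filter_upwards [nhdsWithin_le_nhds h1, hTev p] with ζ h1 h2
        exact hd ζ ⟨h1.1.le, h1.2.le⟩ ((hmemT ζ).1 h2)
      -- The value `h p` is arbitrary, but a constant is also `o((z - p)⁻¹)`, so the hypothesis of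
      -- Riemann's theorem follows from `(z - p) h z → 0`.
      have ho : (fun z => h z - h p) =o[𝓝[≠] (p : ℂ)] fun z => (z - (p : ℂ))⁻¹ := by
        refine (isLittleO_iff_tendsto' ?_).2 ?_
        · filter_upwards [self_mem_nhdsWithin] with ζ hζ h0
          exact absurd (sub_eq_zero.1 (inv_eq_zero.1 h0)) hζ
        · have h2 : Tendsto (fun z : ℂ => (z - p) * h p) (𝓝[≠] (p : ℂ)) (𝓝 0) := by
            refine Tendsto.mono_left (Continuous.tendsto' ?_ _ _ (by simp)) nhdsWithin_le_nhds
            fun_prop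
          have := (hlim p hp).sub h2
          rw [sub_zero] at this
          refine this.congr fun ζ => ?_
          rw [div_inv_eq_mul]; ring
      have := Complex.tendsto_limUnder_of_differentiable_on_punctured_nhds_of_isLittleO hdev ho
      rw [continuousAt_iff_punctured_nhds]
      have hgp : g p = limUnder (𝓝[≠] (p : ℂ)) h := if_pos hzT
      rw [hgp]
      exact this.congr' ((hTev p).mono fun ζ hζ => (hgh ζ hζ).symm)
    · exact (hgd z hz hzT).continuousAt
  have key := Complex.integral_boundary_rect_eq_zero_of_differentiable_on_off_countable g
    ⟨a, -Y⟩ ⟨b, Y⟩ T T.finite_toSet.countable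
    (fun z hz => (hgc z (by
      have := hz.1
      simpa [uIcc_of_le hab.le] using this)).continuousWithinAt)
    (fun z hz => hgd z (by
      have := hz.1.1
      simp only [mem_preimage, min_eq_left hab.le, max_eq_right hab.le] at this
      exact ⟨this.1.le, this.2.le⟩) (by simpa using hz.2))
  have hbd (z : ℂ) (hz : z.im ≠ 0 ∨ z.re = a ∨ z.re = b) : g z = h z := by
    refine hgh z ((hmemT z).2 fun p hp hzp => ?_)
    subst hzp
    simp only [Complex.ofReal_im, Complex.ofReal_re, ne_eq, not_true_eq_false, false_or] at hz
    rcases hz with h | h <;> linarith [(hS p hp).1, (hS p hp).2]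
  have e1 : ∀ x : ℝ, g (x + (-Y : ℝ) * Complex.I) = h (x + (-Y : ℝ) * Complex.I) :=
    fun x => hbd _ (by simp [hY.ne'])
  have e2 : ∀ x : ℝ, g (x + Y * Complex.I) = h (x + Y * Complex.I) :=
    fun x => hbd _ (by simp [hY.ne'])
  have e3 : ∀ y : ℝ, g (b + y * Complex.I) = h (b + y * Complex.I) := fun x => hbd _ (by simp)
  have e4 : ∀ y : ℝ, g (a + y * Complex.I) = h (a + y * Complex.I) := fun x => hbd _ (by simp)
  simpa only [rectIntegral, e1, e2, e3, e4, smul_eq_mul] using key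

/-- The residue theorem for a rectangle and finitely many simple poles on the real line, up to the
value of the boundary integrals of `(z - p)⁻¹`. -/
theorem rectIntegral_eq_sum (hab : a < b) (hY : 0 < Y) {S : Finset ℝ} (hS : ∀ p ∈ S, p ∈ Ioo a b)
    (c : ℝ → ℂ)
    (hd : ∀ z : ℂ, z.re ∈ Icc a b → (∀ p ∈ S, z ≠ (p : ℂ)) → DifferentiableAt ℂ h z)
    (hlim : ∀ p ∈ S, Tendsto (fun z : ℂ => (z - p) * h z) (𝓝[≠] (p : ℂ)) (𝓝 (c p))) :
    rectIntegral h a b Y = ∑ p ∈ S, c p * rectIntegral (fun z => (z - p)⁻¹) a b Y := by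
  have hh : ContinuousAtBoundary h a b := fun z hz hz' => by
    refine (hd z hz fun p hp hzp => ?_).continuousAt
    subst hzp
    simp only [Complex.ofReal_im, Complex.ofReal_re, ne_eq, not_true_eq_false, false_or] at hz'
    rcases hz' with h | h <;> linarith [(hS p hp).1, (hS p hp).2]
  have hk : ∀ p ∈ S, ContinuousAtBoundary (fun z => (z - p)⁻¹) a b :=
    fun p hp => continuousAtBoundary_sub_inv (hS p hp)
  have hk' : ContinuousAtBoundary (fun z => ∑ p ∈ S, c p * (z - p)⁻¹) a b := fun z hz hz' =>
    tendsto_finsetSum _ fun p hp => (hk p hp z hz hz').const_mul _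
  rw [← rectIntegral_sum c hab.le hY hk, ← sub_eq_zero, ← rectIntegral_sub hab.le hY hh hk']
  refine rectIntegral_eq_zero hab hY hS (fun z hz hzS => ?_) fun p hp => ?_
  · refine (hd z hz hzS).sub (DifferentiableAt.fun_sum fun p hp => ?_)
    have : z - p ≠ 0 := sub_ne_zero.2 (hzS p hp)
    fun_prop (disch := assumption)
  -- Only the principal part at `p` itself survives multiplication by `z - p`. Subtracting all
  -- principal parts therefore leaves a removable singularity at every `p`.
  · have h1 : Tendsto (fun z : ℂ => ∑ i ∈ S, (z - p) * (c i * (z - i)⁻¹)) (𝓝[≠] (p : ℂ))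
        (𝓝 (∑ i ∈ S, if i = p then c p else 0)) := by
      refine tendsto_finsetSum _ fun i hi => ?_
      split_ifs with hip
      · subst hip
        refine tendsto_const_nhds.congr' ?_
        filter_upwards [self_mem_nhdsWithin] with z hz
        have : z - i ≠ 0 := sub_ne_zero.2 hz
        field_simp
      · have : (p : ℂ) - i ≠ 0 := sub_ne_zero.2 (by exact_mod_cast Ne.symm hip)
        refine Tendsto.mono_left ?_ nhdsWithin_le_nhds
        have hc : ContinuousAt (fun z : ℂ => (z - p) * (c i * (z - i)⁻¹)) p := by
          fun_prop (disch := assumption)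
        simpa [ContinuousAt] using hc
    rw [Finset.sum_ite_eq' S p, if_pos hp] at h1
    have := (hlim p hp).sub h1
    rw [sub_self] at this
    refine this.congr fun z => ?_
    rw [mul_sub, Finset.mul_sum]

theorem norm_integral_horizontal_le (hab : a ≤ b) {y η : ℝ}
    (hη : ∀ x ∈ Icc a b, ‖h (x + y * Complex.I)‖ ≤ η) :
    ‖∫ x : ℝ in a..b, h (x + y * Complex.I)‖ ≤ η * (b - a) := by
  have := intervalIntegral.norm_integral_le_of_norm_le_const (a := a) (b := b) (C := η)
    (f := fun x : ℝ => h (x + y * Complex.I)) fun x hx => hη x (by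
      rw [uIoc_of_le hab] at hx; exact ⟨hx.1.le, hx.2⟩)
  rwa [abs_of_nonneg (sub_nonneg.2 hab)] at this

/-- The antiderivative is `arctan (y / a) - (I / 2) log (a² + y²)`; its logarithmic part is even and
drops out over a symmetric interval. -/
theorem integral_inv_add_mul_I {a : ℝ} (ha : a ≠ 0) (Y : ℝ) :
    ∫ y : ℝ in (-Y)..Y, ((a : ℂ) + y * Complex.I)⁻¹ = (2 * Real.arctan (Y / a) : ℝ) := by
  have hpos (y : ℝ) : 0 < a ^ 2 + y ^ 2 := by positivity
  have hder (y : ℝ) : HasDerivAt (fun y : ℝ => ((Real.arctan (y / a) : ℝ) : ℂ) -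
      Complex.I / 2 * (Real.log (a ^ 2 + y ^ 2) : ℝ)) (((a : ℂ) + y * Complex.I)⁻¹) y := by
    have h1 : HasDerivAt (fun y : ℝ => Real.arctan (y / a)) (1 / (1 + (y / a) ^ 2) * (1 / a)) y :=
      ((hasDerivAt_id y).div_const a).arctan
    have h2 : HasDerivAt (fun y : ℝ => Real.log (a ^ 2 + y ^ 2))
        ((2 * y) / (a ^ 2 + y ^ 2)) y := by
      have := (((hasDerivAt_id y).pow 2).const_add (a ^ 2)).log (hpos y).ne'
      simpa using this
    have h3 := h1.ofReal_comp.sub (h2.ofReal_comp.const_mul (Complex.I / 2))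
    refine h3.congr_deriv ?_
    have e1 : (1 / (1 + (y / a) ^ 2) * (1 / a) : ℝ) = a / (a ^ 2 + y ^ 2) := by
      field_simp
    rw [e1]
    have hc : ((a : ℂ) ^ 2 + (y : ℂ) ^ 2) ≠ 0 := by exact_mod_cast (hpos y).ne'
    have hfac : ((a : ℂ) + y * Complex.I) * (a - y * Complex.I) = a ^ 2 + y ^ 2 := by
      ring_nf; rw [Complex.I_sq]; ring
    have h4 : ((a : ℂ) + y * Complex.I) ≠ 0 := fun h0 => hc (by rw [← hfac, h0, zero_mul])
    push_cast
    field_simp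
    linear_combination -hfac - 2 * (y : ℂ) ^ 2 * Complex.I_sq
  have hne (y : ℝ) : (a : ℂ) + y * Complex.I ≠ 0 := fun h0 => ha (by
    simpa using congrArg Complex.re h0)
  rw [intervalIntegral.integral_eq_sub_of_hasDerivAt (fun y _ => hder y)
    (Continuous.intervalIntegrable (Continuous.inv₀ (by fun_prop) hne) _ _)]
  rw [neg_div, Real.arctan_neg, neg_sq]
  push_cast
  ring

/-- As `Y → ∞` the horizontal sides contribute `O(1/Y)` and the vertical ones tend to `±π`. The
limit is all that the residue estimate needs, so no winding number at finite height is computed. -/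
theorem tendsto_rectIntegral_sub_inv {p : ℝ} (hp : p ∈ Ioo a b) :
    Tendsto (rectIntegral (fun z => (z - p)⁻¹) a b) atTop (𝓝 (2 * Real.pi * Complex.I)) := by
  have hab : a ≤ b := (hp.1.trans hp.2).le
  have hhor (s : ℝ) (hs : |s| = 1) :
      Tendsto (fun Y : ℝ => ∫ x : ℝ in a..b, (((x : ℂ) + (s * Y : ℝ) * Complex.I) - p)⁻¹) atTop
        (𝓝 0) := by
    have h0 : Tendsto (fun Y : ℝ => Y⁻¹ * (b - a)) atTop (𝓝 0) := by
      simpa using tendsto_inv_atTop_zero.mul_const (b - a)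
    refine squeeze_zero_norm' ?_ h0
    filter_upwards [eventually_gt_atTop 0] with Y hY
    refine norm_integral_horizontal_le (h := fun z => (z - p)⁻¹) hab fun x _ => ?_
    rw [norm_inv]
    refine inv_anti₀ hY ?_
    have := Complex.abs_im_le_norm ((x : ℂ) + (s * Y : ℝ) * Complex.I - p)
    simpa [abs_mul, hs, abs_of_pos hY] using this
  have hbot : Tendsto (fun Y : ℝ => ∫ x : ℝ in a..b, (((x : ℂ) + (-Y : ℝ) * Complex.I) - p)⁻¹)
      atTop (𝓝 0) := by simpa using hhor (-1) (by simp)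
  have htop : Tendsto (fun Y : ℝ => ∫ x : ℝ in a..b, (((x : ℂ) + Y * Complex.I) - p)⁻¹)
      atTop (𝓝 0) := by simpa using hhor 1 (by simp)
  have hver (x Y : ℝ) (hx : x - p ≠ 0) : ∫ y : ℝ in (-Y)..Y, (((x : ℂ) + y * Complex.I) - p)⁻¹ =
      (2 * Real.arctan (Y / (x - p)) : ℝ) := by
    rw [← integral_inv_add_mul_I hx]
    refine intervalIntegral.integral_congr fun y _ => ?_
    push_cast; ring_nf
  have hright : Tendsto (fun Y : ℝ => ∫ y : ℝ in (-Y)..Y, (((b : ℂ) + y * Complex.I) - p)⁻¹)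
      atTop (𝓝 (Real.pi : ℝ)) := by
    have hb : 0 < b - p := sub_pos.2 hp.2
    simp_rw [hver b _ hb.ne']
    refine (Complex.continuous_ofReal.tendsto _).comp ?_
    have : Tendsto (fun Y : ℝ => Real.arctan (Y / (b - p))) atTop (𝓝 (Real.pi / 2)) :=
      (Real.tendsto_arctan_atTop.mono_right nhdsWithin_le_nhds).comp
        (tendsto_id.atTop_div_const hb)
    simpa [mul_div_cancel₀] using this.const_mul 2
  have hleft : Tendsto (fun Y : ℝ => ∫ y : ℝ in (-Y)..Y, (((a : ℂ) + y * Complex.I) - p)⁻¹)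
      atTop (𝓝 ((-Real.pi : ℝ) : ℂ)) := by
    have ha : 0 < p - a := sub_pos.2 hp.1
    have ha' : a - p ≠ 0 := by linarith
    simp_rw [hver a _ ha']
    refine (Complex.continuous_ofReal.tendsto _).comp ?_
    have : Tendsto (fun Y : ℝ => Real.arctan (Y / (p - a))) atTop (𝓝 (Real.pi / 2)) :=
      (Real.tendsto_arctan_atTop.mono_right nhdsWithin_le_nhds).comp
        (tendsto_id.atTop_div_const ha)
    have h2 := this.const_mul (-2)
    have e : -2 * (Real.pi / 2) = -Real.pi := by ring
    rw [e] at h2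
    refine h2.congr fun Y => ?_
    rw [← neg_sub p a, div_neg, Real.arctan_neg]; ring
  have := ((hbot.sub htop).add (hright.const_mul Complex.I)).sub (hleft.const_mul Complex.I)
  have e : (0 - 0 + Complex.I * Real.pi - Complex.I * (-Real.pi : ℝ) : ℂ) =
      2 * Real.pi * Complex.I := by push_cast; ring
  rw [e] at this
  exact this

theorem integral_exp_neg_mul_abs_le {δ Y : ℝ} (hδ : 0 < δ) (hY : 0 ≤ Y) :
    ∫ y : ℝ in (-Y)..Y, Real.exp (-(δ * |y|)) ≤ 2 / δ := by
  have hpos : ∫ y : ℝ in (0)..Y, Real.exp (-(δ * |y|)) ≤ 1 / δ := by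
    have h1 : ∫ y : ℝ in (0)..Y, Real.exp (-(δ * |y|)) = ∫ y : ℝ in (0)..Y, Real.exp (-δ * y) := by
      refine intervalIntegral.integral_congr fun y hy => ?_
      rw [uIcc_of_le hY] at hy
      simp only [abs_of_nonneg hy.1, neg_mul]
    rw [h1, intervalIntegral.integral_comp_mul_left (fun y => Real.exp y) (by linarith),
      integral_exp, mul_zero, Real.exp_zero, smul_eq_mul, ← div_eq_inv_mul, div_neg, ← neg_div]
    gcongr
    linarith [Real.exp_pos (-δ * Y)]
  have hneg : ∫ y : ℝ in (-Y)..0, Real.exp (-(δ * |y|)) =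
      ∫ y : ℝ in (0)..Y, Real.exp (-(δ * |y|)) := by
    rw [← neg_zero, ← intervalIntegral.integral_comp_neg (fun y => Real.exp (-(δ * |y|)))]
    simp
  have hc : Continuous fun y : ℝ => Real.exp (-(δ * |y|)) := by fun_prop
  rw [← intervalIntegral.integral_add_adjacent_intervals (hc.intervalIntegrable (-Y) 0)
    (hc.intervalIntegrable 0 Y), hneg]
  calc _ ≤ 1 / δ + 1 / δ := add_le_add hpos hpos
    _ = 2 / δ := by ring

theorem norm_integral_vertical_le {x Y K δ : ℝ} (hδ : 0 < δ) (hY : 0 ≤ Y) (hK : 0 ≤ K)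
    (hh : ∀ y : ℝ, ‖h (x + y * Complex.I)‖ ≤ K * Real.exp (-(δ * |y|))) :
    ‖∫ y : ℝ in (-Y)..Y, h (x + y * Complex.I)‖ ≤ 2 * K / δ := by
  have hc : Continuous fun y : ℝ => K * Real.exp (-(δ * |y|)) := by fun_prop
  refine (intervalIntegral.norm_integral_le_of_norm_le (by linarith)
    (Eventually.of_forall fun y _ => hh y) (hc.intervalIntegrable _ _)).trans ?_
  rw [intervalIntegral.integral_const_mul]
  calc _ ≤ K * (2 / δ) := by gcongr; exact integral_exp_neg_mul_abs_le hδ hY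
    _ = _ := by ring

/-- The sum of the residues in a vertical strip of a function that decays exponentially on the two
sides of the strip and vanishes at infinity. -/
theorem norm_sum_residues_le (hab : a < b) {S : Finset ℝ} (hS : ∀ p ∈ S, p ∈ Ioo a b) (c : ℝ → ℂ)
    (hd : ∀ z : ℂ, z.re ∈ Icc a b → (∀ p ∈ S, z ≠ (p : ℂ)) → DifferentiableAt ℂ h z)
    (hlim : ∀ p ∈ S, Tendsto (fun z : ℂ => (z - p) * h z) (𝓝[≠] (p : ℂ)) (𝓝 (c p)))
    {K δ : ℝ} (hδ : 0 < δ) (hK : 0 ≤ K)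
    (ha : ∀ y : ℝ, ‖h (a + y * Complex.I)‖ ≤ K * Real.exp (-(δ * |y|)))
    (hb : ∀ y : ℝ, ‖h (b + y * Complex.I)‖ ≤ K * Real.exp (-(δ * |y|)))
    {η : ℝ → ℝ} (hη : Tendsto η atTop (𝓝 0))
    (hη' : ∀ᶠ Y in atTop, ∀ x ∈ Icc a b, ∀ y : ℝ, |y| = Y → ‖h (x + y * Complex.I)‖ ≤ η Y) :
    ‖∑ p ∈ S, c p‖ ≤ 2 * K / (Real.pi * δ) := by
  have h1 : Tendsto (fun Y => ‖∑ p ∈ S, c p * rectIntegral (fun z => (z - p)⁻¹) a b Y‖) atTop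
      (𝓝 ‖∑ p ∈ S, c p * (2 * Real.pi * Complex.I)‖) :=
    (tendsto_finsetSum _ fun p hp =>
      (tendsto_rectIntegral_sub_inv (hS p hp)).const_mul (c p)).norm
  have h2 : Tendsto (fun Y => 2 * (η Y * (b - a)) + 4 * K / δ) atTop (𝓝 (4 * K / δ)) := by
    have := ((hη.mul_const (b - a)).const_mul 2).add_const (4 * K / δ)
    simpa using this
  have h3 : ‖∑ p ∈ S, c p * (2 * Real.pi * Complex.I)‖ ≤ 4 * K / δ := by
    refine le_of_tendsto_of_tendsto h1 h2 ?_
    filter_upwards [hη', eventually_gt_atTop 0] with Y hY hY0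
    rw [← rectIntegral_eq_sum hab hY0 hS c hd hlim, rectIntegral]
    have e1 := norm_integral_horizontal_le (h := h) hab.le (y := -Y) (η := η Y)
      fun x hx => hY x hx (-Y) (by rw [abs_neg, abs_of_pos hY0])
    have e2 := norm_integral_horizontal_le (h := h) hab.le (y := Y) (η := η Y)
      fun x hx => hY x hx Y (abs_of_pos hY0)
    have e3 := norm_integral_vertical_le hδ hY0.le hK hb
    have e4 := norm_integral_vertical_le hδ hY0.le hK ha
    refine (norm_sub_le _ _).trans ?_
    refine (add_le_add_left (norm_add_le _ _) _).trans ?_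
    refine (add_le_add_left (add_le_add_left (norm_sub_le _ _) _) _).trans ?_
    rw [norm_mul, norm_mul, Complex.norm_I, one_mul, one_mul]
    have : 4 * K / δ = 2 * K / δ + 2 * K / δ := by ring
    linarith
  rw [← Finset.sum_mul, norm_mul, norm_mul, norm_mul, Complex.norm_I, Complex.norm_real,
    Real.norm_of_nonneg Real.pi_pos.le, Complex.norm_ofNat] at h3
  rw [le_div_iff₀ (by positivity)]
  rw [le_div_iff₀ hδ] at h3
  linarith

/-! ### The truncation error of the sampling series -/

/-- The cosine term vanishes at half-integer multiples of `π`, which leaves the modulus `cosh (w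
y)`. -/
theorem le_norm_sin_of_half_integer {w x : ℝ} (m : ℤ) (hx : w * x = m * Real.pi + Real.pi / 2)
    (y : ℝ) : Real.exp (w * |y|) / 2 ≤ ‖Complex.sin (w * (x + y * Complex.I))‖ := by
  have h1 : (w : ℂ) * (x + y * Complex.I) = (w * x : ℝ) + (w * y : ℝ) * Complex.I := by
    push_cast; ring
  have hc : Real.cos (w * x) = 0 := by
    rw [hx, Real.cos_add_pi_div_two, Real.sin_int_mul_pi, neg_zero]
  have hs : |Real.sin (w * x)| = 1 := by
    rw [hx, Real.sin_add_pi_div_two, Real.abs_cos_int_mul_pi]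
  rw [h1, Complex.sin_add_mul_I, ← Complex.ofReal_cos, hc, Complex.ofReal_zero, zero_mul, zero_mul,
    add_zero, ← Complex.ofReal_sin, ← Complex.ofReal_cosh, norm_mul, Complex.norm_real,
    Complex.norm_real, Real.norm_eq_abs, hs, one_mul, Real.norm_of_nonneg (Real.cosh_pos _).le,
    Real.cosh_eq]
  rcases abs_choice y with h | h <;> rw [h]
  · linarith [Real.exp_pos (-(w * y))]
  · rw [mul_neg]; linarith [Real.exp_pos (w * y)]

theorem le_norm_sin_of_im {z : ℂ} : (Real.exp |z.im| - 1) / 2 ≤ ‖Complex.sin z‖ := by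
  have e1 : ‖Complex.exp (-z * Complex.I)‖ = Real.exp z.im := by
    rw [Complex.norm_exp]; simp
  have e2 : ‖Complex.exp (z * Complex.I)‖ = Real.exp (-z.im) := by
    rw [Complex.norm_exp]; simp
  rw [Complex.sin, norm_div, norm_mul, Complex.norm_I, mul_one, Complex.norm_ofNat]
  gcongr
  have h1 := norm_sub_norm_le (Complex.exp (-z * Complex.I)) (Complex.exp (z * Complex.I))
  have h2 := norm_sub_norm_le (Complex.exp (z * Complex.I)) (Complex.exp (-z * Complex.I))
  rw [norm_sub_rev (Complex.exp (z * Complex.I))] at h2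
  rw [e1, e2] at h1 h2
  rcases le_total 0 z.im with h | h
  · rw [abs_of_nonneg h]
    linarith [Real.exp_le_one_iff.2 (neg_nonpos.2 h)]
  · rw [abs_of_nonpos h]
    linarith [Real.exp_le_one_iff.2 h]

theorem tendsto_mul_div_of_hasDerivAt {g D : ℂ → ℂ} {p D' : ℂ} (hg : ContinuousAt g p)
    (hD : HasDerivAt D D' p) (hp : D p = 0) (hD' : D' ≠ 0) :
    Tendsto (fun z => (z - p) * (g z / D z)) (𝓝[≠] p) (𝓝 (g p / D')) := by
  have h1 := hasDerivAt_iff_tendsto_slope.1 hD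
  have h2 : Tendsto g (𝓝[≠] p) (𝓝 (g p)) := hg.tendsto.mono_left nhdsWithin_le_nhds
  refine (h2.div h1 hD').congr fun z => ?_
  rw [Pi.div_apply, slope_def_field, hp, sub_zero]
  simp only [div_eq_mul_inv, mul_inv_rev, inv_inv]
  ring

theorem sin_int_mul_pi_complex (k : ℤ) : Complex.sin (k * Real.pi) = 0 :=
  Complex.sin_eq_zero_iff.2 ⟨k, rfl⟩

theorem cos_int_mul_pi_sq (k : ℤ) : Real.cos (k * Real.pi) * Real.cos (k * Real.pi) = 1 := by
  have := Real.sin_sq_add_cos_sq (k * Real.pi)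
  rw [Real.sin_int_mul_pi] at this
  linarith

/-- The residue of `sin (w t) g z / ((z - t) sin (w z))` at a sampling point. -/
theorem sin_mul_residue_eq (w t : ℝ) (hw : w ≠ 0) (n : ℤ) (hn : w * t - n * Real.pi ≠ 0) (G : ℂ) :
    (Real.sin (w * t) : ℂ) * (G / ((((n * Real.pi / w : ℝ) : ℂ) - t) *
      ((Real.cos (n * Real.pi) : ℝ) * w))) = -((Real.sinc (w * t - n * Real.pi) : ℂ) * G) := by
  rw [Real.sinc_of_ne_zero hn, Real.sin_sub, Real.sin_int_mul_pi, mul_zero, sub_zero]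
  have hc := cos_int_mul_pi_sq n
  have hc0 : Real.cos (n * Real.pi) ≠ 0 := fun h0 => by simp [h0] at hc
  have e : (n * Real.pi / w - t) * (Real.cos (n * Real.pi) * w) =
      -((w * t - n * Real.pi) * Real.cos (n * Real.pi)) := by
    field_simp; ring
  have e2 : Real.sin (w * t) * (1 / ((n * Real.pi / w - t) * (Real.cos (n * Real.pi) * w))) =
      -(Real.sin (w * t) * Real.cos (n * Real.pi) / (w * t - n * Real.pi)) := by
    rw [e]
    field_simp
    linear_combination Real.sin (w * t) * hc
  have e3 := congrArg (fun r : ℝ => (r : ℂ)) e2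
  push_cast at e3 ⊢
  linear_combination G * e3

/-- The truncation error of the time shifted sampling series of an entire function of exponential
type less than `w` that is bounded on the real line. -/
theorem norm_sub_sum_sinc_le {g : ℂ → ℂ} (hg : Differentiable ℂ g) {L γ w : ℝ} (hγ : 0 ≤ γ)
    (hw : γ < w) (hL : 0 ≤ L) (hb : ∀ z, ‖g z‖ ≤ L * Real.exp (γ * |z.im|)) {N : ℕ} (hN : 1 ≤ N)
    (t : ℝ) :
    ‖g t - ∑ n ∈ indexSet w N t, (Real.sinc (w * t - n * Real.pi) : ℂ) *
        g ((n * Real.pi / w : ℝ) : ℂ)‖ ≤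
      8 * L * w * |Real.sin (w * t)| / (Real.pi ^ 2 * (w - γ) * N) := by
  classical
  have hw0 : 0 < w := hγ.trans_lt hw
  have hpi := Real.pi_pos
  have hN0 : (1 : ℝ) ≤ N := by exact_mod_cast hN
  have hδ : 0 < w - γ := sub_pos.2 hw
  -- If `sin (w t) = 0`, then `t` is a node and the pole there would be double. In that case the
  -- series is exact: its only nonzero weight is `sinc 0 = 1`.
  by_cases hs : Real.sin (w * t) = 0
  · obtain ⟨m, hm⟩ := Real.sin_eq_zero_iff.1 hs
    have hmI : m ∈ indexSet w N t := by
      rw [mem_indexSet, ← hm, mul_div_cancel_right₀ _ hpi.ne']; simp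
    rw [Finset.sum_eq_single_of_mem m hmI, ← hm, sub_self, Real.sinc_zero, mul_div_right_comm,
      mul_div_right_comm, hm]
    · have : (m : ℝ) / w * Real.pi = t := by field_simp; linarith
      rw [this]; simp [hs]
    · intro n _ hn
      have hne : w * t - n * Real.pi ≠ 0 := by
        rw [← hm, ← sub_mul]
        exact mul_ne_zero (sub_ne_zero.2 (by exact_mod_cast hn.symm)) hpi.ne'
      rw [Real.sinc_of_ne_zero hne, ← hm, ← sub_mul]
      have : Real.sin (((m : ℝ) - n) * Real.pi) = 0 := by
        exact_mod_cast Real.sin_int_mul_pi (m - n)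
      simp [this]
  have hne (n : ℤ) : w * t - n * Real.pi ≠ 0 := fun h0 => hs (by
    rw [sub_eq_zero.1 h0, Real.sin_int_mul_pi])
  have hnode (n : ℤ) : (n * Real.pi / w : ℝ) ≠ t := fun h0 => hne n (by
    rw [← h0]; field_simp; ring)
  set A : ℤ := ⌈w * t / Real.pi - N⌉ with hA
  set B : ℤ := ⌊w * t / Real.pi + N⌋ with hB
  -- The sides lie half a spacing beyond the extreme nodes `A` and `B`, where `|sin (w z)|` is
  -- largest.
  set a : ℝ := (A * Real.pi - Real.pi / 2) / w with ha
  set b : ℝ := (B * Real.pi + Real.pi / 2) / w with hb'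
  have hwa : w * a = A * Real.pi - Real.pi / 2 := by rw [ha]; field_simp
  have hwb : w * b = B * Real.pi + Real.pi / 2 := by rw [hb']; field_simp
  have hA1 : (A : ℝ) * Real.pi < w * t - N * Real.pi + Real.pi := by
    have := Int.ceil_lt_add_one (w * t / Real.pi - N)
    rw [← hA] at this
    have h2 := mul_lt_mul_of_pos_right this hpi
    rwa [add_mul, sub_mul, div_mul_cancel₀ _ hpi.ne', one_mul] at h2
  have hB1 : w * t + N * Real.pi - Real.pi < (B : ℝ) * Real.pi := by
    have := Int.sub_one_lt_floor (w * t / Real.pi + N)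
    rw [← hB] at this
    have h2 := mul_lt_mul_of_pos_right this hpi
    rwa [sub_mul, add_mul, div_mul_cancel₀ _ hpi.ne', one_mul] at h2
  have hNpi : Real.pi ≤ N * Real.pi := le_mul_of_one_le_left hpi.le hN0
  -- Rounding costs less than one spacing and the half-spacing margin restores half of it, so each
  -- side is at least `(N - 1/2) π / w` from `t`. For `N ≥ 1` this is at least `d`.
  set d : ℝ := N * Real.pi / (2 * w) with hd
  have hd0 : 0 < d := by positivity
  have hwd : w * d = N * Real.pi / 2 := by rw [hd]; field_simp
  have hta : d ≤ t - a := by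
    have : w * d ≤ w * (t - a) := by rw [mul_sub, hwd, hwa]; linarith
    exact le_of_mul_le_mul_left this hw0
  have htb : d ≤ b - t := by
    have : w * d ≤ w * (b - t) := by rw [mul_sub, hwd, hwb]; linarith
    exact le_of_mul_le_mul_left this hw0
  have hab : a < b := by linarith
  set node : ℤ → ℝ := fun n => n * Real.pi / w with hnodedef
  have hinj : Function.Injective node := fun m n hmn => by
    have h1 : (m : ℝ) * Real.pi / w = n * Real.pi / w := hmn
    rw [div_left_inj' hw0.ne', mul_left_inj' hpi.ne'] at h1
    exact_mod_cast h1
  set S : Finset ℝ := insert t ((indexSet w N t).image node) with hSdef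
  have htS : t ∉ (indexSet w N t).image node := by
    simp only [Finset.mem_image, not_exists, not_and]
    exact fun n _ => hnode n
  have hS : ∀ p ∈ S, p ∈ Ioo a b := by
    intro p hp
    rcases Finset.mem_insert.1 hp with rfl | hp
    · exact ⟨by linarith, by linarith⟩
    · obtain ⟨n, hn, rfl⟩ := Finset.mem_image.1 hp
      obtain ⟨h1, h2⟩ := Finset.mem_Icc.1 hn
      have h1' : (A : ℝ) * Real.pi ≤ n * Real.pi := by
        have : (A : ℝ) ≤ n := by exact_mod_cast h1
        gcongr
      have h2' : (n : ℝ) * Real.pi ≤ B * Real.pi := by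
        have : (n : ℝ) ≤ B := by exact_mod_cast h2
        gcongr
      constructor
      · exact div_lt_div_of_pos_right (by linarith) hw0
      · exact div_lt_div_of_pos_right (by linarith) hw0
  set D : ℂ → ℂ := fun z => (z - t) * Complex.sin (w * z) with hD
  set D' : ℂ → ℂ := fun z => Complex.sin (w * z) + (z - t) * (Complex.cos (w * z) * w) with hD'
  have hDd (z : ℂ) : HasDerivAt D (D' z) z := by
    have h1 : HasDerivAt (fun z : ℂ => z - t) 1 z := (hasDerivAt_id z).sub_const _
    have h2 : HasDerivAt (fun z : ℂ => Complex.sin (w * z)) (Complex.cos (w * z) * w) z := by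
      have := ((hasDerivAt_id z).const_mul (w : ℂ)).csin
      simpa using this
    refine (h1.mul h2).congr_deriv ?_
    rw [one_mul]
  have hDt : D' t = Real.sin (w * t) := by simp [hD']
  have hwnode (n : ℤ) : (w : ℂ) * (node n : ℝ) = n * Real.pi := by
    have : w * node n = n * Real.pi := by simp only [hnodedef]; field_simp
    exact_mod_cast this
  have hDn (n : ℤ) : D' (node n : ℝ) =
      (((n * Real.pi / w : ℝ) : ℂ) - t) * ((Real.cos (n * Real.pi) : ℝ) * w) := by
    simp only [hD', hwnode, sin_int_mul_pi_complex, zero_add]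
    push_cast [hnodedef]; rfl
  -- A further zero in the strip would be a node with index `k` satisfying `A - 1/2 ≤ k ≤ B + 1/2`,
  -- and integrality puts it back in the index set.
  have hzero (z : ℂ) (hz : z.re ∈ Icc a b) (hzS : ∀ p ∈ S, z ≠ (p : ℂ)) : D z ≠ 0 := by
    intro h0
    rcases mul_eq_zero.1 h0 with h1 | h1
    · exact hzS t (Finset.mem_insert_self _ _) (sub_eq_zero.1 h1)
    · obtain ⟨k, hk⟩ := Complex.sin_eq_zero_iff.1 h1
      have hzk : z = (node k : ℝ) := by
        have hwc : (w : ℂ) ≠ 0 := by exact_mod_cast hw0.ne'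
        refine mul_left_cancel₀ hwc ?_
        rw [hk, hwnode]
      refine hzS (node k) (Finset.mem_insert_of_mem (Finset.mem_image_of_mem _ ?_)) hzk
      rw [hzk, Complex.ofReal_re] at hz
      have hk1 : w * a ≤ k * Real.pi := by
        have := mul_le_mul_of_nonneg_left hz.1 hw0.le
        rwa [show w * node k = k * Real.pi by simp only [hnodedef]; field_simp] at this
      have hk2 : k * Real.pi ≤ w * b := by
        have := mul_le_mul_of_nonneg_left hz.2 hw0.le
        rwa [show w * node k = k * Real.pi by simp only [hnodedef]; field_simp] at this
      rw [hwa] at hk1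
      rw [hwb] at hk2
      refine Finset.mem_Icc.2 ⟨?_, ?_⟩
      · have : ((A - 1 : ℤ) : ℝ) < k := by
          push_cast
          nlinarith
        have := Int.cast_lt.1 this
        change A ≤ k
        linarith [Int.lt_iff_add_one_le.1 this]
      · have : (k : ℝ) < ((B + 1 : ℤ) : ℝ) := by
          push_cast
          nlinarith
        have := Int.cast_lt.1 this
        change k ≤ B
        linarith [Int.lt_iff_add_one_le.1 this]
  have hlim : ∀ p ∈ S, Tendsto (fun z : ℂ => (z - p) * (g z / D z)) (𝓝[≠] (p : ℂ))
      (𝓝 (g p / D' p)) := by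
    intro p hp
    refine tendsto_mul_div_of_hasDerivAt hg.continuous.continuousAt (hDd p) ?_ ?_
    · rcases Finset.mem_insert.1 hp with rfl | hp
      · simp [hD]
      · obtain ⟨n, hn, rfl⟩ := Finset.mem_image.1 hp
        simp only [hD, hwnode, sin_int_mul_pi_complex, mul_zero]
    · rcases Finset.mem_insert.1 hp with rfl | hp
      · rw [hDt]; exact_mod_cast hs
      · obtain ⟨n, hn, rfl⟩ := Finset.mem_image.1 hp
        rw [hDn]
        have hc := cos_int_mul_pi_sq n
        have hc0 : Real.cos (n * Real.pi) ≠ 0 := fun h0 => by simp [h0] at hc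
        exact_mod_cast mul_ne_zero (sub_ne_zero.2 (hnode n)) (mul_ne_zero hc0 hw0.ne')
  have hvert (x : ℝ) (m : ℤ) (hx : w * x = m * Real.pi + Real.pi / 2) (hxt : d ≤ |x - t|) (y : ℝ) :
      ‖g (x + y * Complex.I) / D (x + y * Complex.I)‖ ≤
        (2 * L / d) * Real.exp (-((w - γ) * |y|)) := by
    have h1 := le_norm_sin_of_half_integer m hx y
    have h2 : d ≤ ‖(x + y * Complex.I : ℂ) - t‖ := by
      refine hxt.trans ?_
      simpa using Complex.abs_re_le_norm ((x + y * Complex.I : ℂ) - t)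
    have h3 : ‖g (x + y * Complex.I)‖ ≤ L * Real.exp (γ * |y|) := by
      simpa using hb (x + y * Complex.I)
    rw [norm_div, norm_mul]
    calc _ ≤ L * Real.exp (γ * |y|) / (d * (Real.exp (w * |y|) / 2)) := by gcongr
      _ = (2 * L / d) * (Real.exp (γ * |y|) / Real.exp (w * |y|)) := by
        field_simp
      _ = _ := by rw [← Real.exp_sub]; ring_nf
  have hη : ∀ᶠ Y in atTop, ∀ x ∈ Icc a b, ∀ y : ℝ, |y| = Y →
      ‖g (x + y * Complex.I) / D (x + y * Complex.I)‖ ≤ 4 * L * Y⁻¹ := by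
    -- From `w Y ≥ 1` follows `exp (w Y) ≥ 2`, hence `(exp (w Y) - 1) / 2 ≥ exp (w Y) / 4`.
    filter_upwards [eventually_ge_atTop (1 / w), eventually_gt_atTop 0] with Y hY hY0 x _ y hy
    have hwY : 1 ≤ w * Y := by
      rw [div_le_iff₀ hw0] at hY; linarith
    have h1 := le_norm_sin_of_im (z := w * (x + y * Complex.I))
    have him : |((w : ℂ) * (x + y * Complex.I)).im| = w * Y := by
      simp [abs_mul, abs_of_pos hw0, hy]
    rw [him] at h1
    have h2 : Real.exp (w * Y) / 4 ≤ ‖Complex.sin (w * (x + y * Complex.I))‖ := by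
      linarith [Real.add_one_le_exp (w * Y)]
    have h3 : Y ≤ ‖(x + y * Complex.I : ℂ) - t‖ := by
      have := Complex.abs_im_le_norm ((x + y * Complex.I : ℂ) - t)
      simpa [hy] using this
    have h4 : ‖g (x + y * Complex.I)‖ ≤ L * Real.exp (γ * Y) := by
      simpa [hy] using hb (x + y * Complex.I)
    have h5 : Real.exp (γ * Y) ≤ Real.exp (w * Y) := Real.exp_le_exp.2 (by gcongr)
    rw [norm_div, norm_mul]
    calc _ ≤ L * Real.exp (w * Y) / (Y * (Real.exp (w * Y) / 4)) := by
          gcongr; exact h4.trans (by gcongr)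
      _ = 4 * L * Y⁻¹ := by field_simp
  have hη0 : Tendsto (fun Y : ℝ => 4 * L * Y⁻¹) atTop (𝓝 0) := by
    simpa using tendsto_inv_atTop_zero.const_mul (4 * L)
  have hres := norm_sum_residues_le (h := fun z => g z / D z) hab hS (fun p => g p / D' p)
    (fun z hz hzS => (hg z).div (hDd z).differentiableAt (hzero z hz hzS)) hlim hδ
    (K := 2 * L / d) (by positivity)
    (hvert a (A - 1) (by rw [hwa]; push_cast; ring)
      (by rw [abs_sub_comm]; exact hta.trans (le_abs_self _)))
    (hvert b B hwb (htb.trans (le_abs_self _))) hη0 hη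
  have hsum : g t - ∑ n ∈ indexSet w N t, (Real.sinc (w * t - n * Real.pi) : ℂ) *
      g ((n * Real.pi / w : ℝ) : ℂ) = (Real.sin (w * t) : ℂ) * ∑ p ∈ S, g p / D' p := by
    rw [hSdef, Finset.sum_insert htS, Finset.sum_image fun _ _ _ _ h => hinj h, mul_add,
      Finset.mul_sum, hDt, mul_div_cancel₀ _ (by exact_mod_cast hs), sub_eq_add_neg,
      ← Finset.sum_neg_distrib]
    congr 1
    refine Finset.sum_congr rfl fun n _ => ?_
    rw [hDn, sin_mul_residue_eq w t hw0.ne' n (hne n)]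
  rw [hsum, norm_mul, Complex.norm_real, Real.norm_eq_abs]
  calc _ ≤ |Real.sin (w * t)| * (2 * (2 * L / d) / (Real.pi * (w - γ))) := by gcongr
    _ = _ := by rw [hd]; field_simp; ring

/-! ### Second order processes as curves in `L²` -/

section SecondOrder

variable {Ω : Type*} [MeasurableSpace Ω] {P : Measure Ω} {ξ : ℝ → Ω → ℂ}

theorem inner_toLp (hm : ∀ t, MemLp (ξ t) 2 P) (s t : ℝ) :
    inner ℂ ((hm s).toLp (ξ s)) ((hm t).toLp (ξ t)) = cov P ξ t s := by
  rw [L2.inner_def, cov]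
  refine integral_congr_ae ?_
  filter_upwards [(hm s).coeFn_toLp, (hm t).coeFn_toLp] with ω h1 h2
  rw [h1, h2, RCLike.inner_apply]

theorem norm_sq_Lp_eq_integral (X : Lp ℂ 2 P) : ‖X‖ ^ 2 = ∫ ω, ‖X ω‖ ^ 2 ∂P := by
  have h1 := inner_self_eq_norm_sq_to_K (𝕜 := ℂ) X
  rw [L2.inner_def] at h1
  simp only [inner_self_eq_norm_sq_to_K] at h1
  have h2 : (∫ ω, (((‖X ω‖ ^ 2 : ℝ)) : ℂ) ∂P) = ((‖X‖ ^ 2 : ℝ) : ℂ) := by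
    push_cast; exact h1
  rw [integral_complex_ofReal] at h2
  exact_mod_cast h2.symm

theorem meanSquareError_eq (hm : ∀ t, MemLp (ξ t) 2 P) (t : ℝ) (Y : Lp ℂ 2 P) :
    meanSquareError P (ξ t) Y = ‖(hm t).toLp (ξ t) - Y‖ ^ 2 := by
  rw [norm_sq_Lp_eq_integral, meanSquareError]
  refine integral_congr_ae ?_
  filter_upwards [(hm t).coeFn_toLp, Lp.coeFn_sub ((hm t).toLp (ξ t)) Y] with ω h1 h2
  rw [h2, Pi.sub_apply, h1]

theorem norm_sq_increment (hm : ∀ t, MemLp (ξ t) 2 P) (s t : ℝ) :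
    ‖(hm t).toLp (ξ t) - (hm s).toLp (ξ s)‖ ^ 2 =
      (cov P ξ t t - cov P ξ t s - cov P ξ s t + cov P ξ s s).re := by
  have h := inner_self_eq_norm_sq_to_K (𝕜 := ℂ) ((hm t).toLp (ξ t) - (hm s).toLp (ξ s))
  rw [inner_sub_left, inner_sub_right, inner_sub_right, inner_toLp, inner_toLp, inner_toLp,
    inner_toLp] at h
  have h2 : ((‖(hm t).toLp (ξ t) - (hm s).toLp (ξ s)‖ ^ 2 : ℝ) : ℂ) =
      cov P ξ t t - cov P ξ t s - cov P ξ s t + cov P ξ s s := by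
    push_cast
    refine Eq.trans h.symm ?_
    ring
  rw [← h2, Complex.ofReal_re]

theorem continuous_toLp (hm : ∀ t, MemLp (ξ t) 2 P)
    (hB : Continuous fun x : ℝ × ℝ => cov P ξ x.1 x.2) :
    Continuous fun t => (hm t).toLp (ξ t) := by
  refine continuous_iff_continuousAt.2 fun s => ?_
  rw [ContinuousAt, tendsto_iff_norm_sub_tendsto_zero]
  have hc (u v : ℝ → ℝ) (hu : Continuous u) (hv : Continuous v) :
      Continuous fun t => cov P ξ (u t) (v t) := hB.comp (hu.prodMk hv)
  have h1 : Continuous fun t => ‖(hm t).toLp (ξ t) - (hm s).toLp (ξ s)‖ ^ 2 := by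
    simp_rw [norm_sq_increment hm s]
    exact Complex.continuous_re.comp ((((hc _ _ continuous_id continuous_id).sub
      (hc _ _ continuous_id continuous_const)).sub
      (hc _ _ continuous_const continuous_id)).add continuous_const)
  have h2 := (Real.continuous_sqrt.comp h1).tendsto s
  simpa [Function.comp_def, Real.sqrt_sq (norm_nonneg _)] using h2

end SecondOrder

/-- The second difference of a `C²` function of two variables along the diagonal. -/
theorem eventually_norm_second_difference_le {B : ℝ → ℝ → ℂ}
    (hB : ContDiff ℝ 2 fun x : ℝ × ℝ => B x.1 x.2) (s : ℝ) {ε : ℝ} (hε : 0 < ε) :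
    ∀ᶠ z in 𝓝[>] s,
      ‖B z z - B z s - B s z + B s s‖ ≤ (‖diagDeriv B s‖ + ε) * (z - s) ^ 2 := by
  set G : ℝ × ℝ → ℂ := fun x => B x.1 x.2 with hG
  set G₂ : ℝ × ℝ → ℂ := fun x => fderiv ℝ G x (0, 1) with hG₂
  set G₁₂ : ℝ × ℝ → ℂ := fun x => fderiv ℝ G₂ x (1, 0) with hG₁₂
  have hC₂ : ContDiff ℝ 1 G₂ := (hB.fderiv_right (m := 1) (by norm_num)).clm_apply contDiff_const
  have hC₁₂ : Continuous G₁₂ :=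
    ((hC₂.fderiv_right (m := 0) (by norm_num)).clm_apply contDiff_const).continuous
  have hd₂ (r v : ℝ) : HasDerivAt (fun v => B r v) (G₂ (r, v)) v := by
    have h1 : HasFDerivAt G (fderiv ℝ G (r, v)) (r, v) :=
      (hB.differentiable (by norm_num) (r, v)).hasFDerivAt
    exact h1.comp_hasDerivAt v ((hasDerivAt_const v r).prodMk (hasDerivAt_id v))
  have hd₁₂ (r v : ℝ) : HasDerivAt (fun r => G₂ (r, v)) (G₁₂ (r, v)) r := by
    have h1 : HasFDerivAt G₂ (fderiv ℝ G₂ (r, v)) (r, v) :=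
      (hC₂.differentiable (by norm_num) (r, v)).hasFDerivAt
    exact h1.comp_hasDerivAt r ((hasDerivAt_id r).prodMk (hasDerivAt_const r v))
  have hdiag : diagDeriv B s = G₁₂ (s, s) := by
    rw [diagDeriv]
    simp_rw [fun r => (hd₂ r s).deriv]
    exact (hd₁₂ s s).deriv
  set c := G₁₂ (s, s) with hc
  rw [hdiag]
  obtain ⟨δ, hδ, hball⟩ := Metric.continuous_iff.1 hC₁₂ (s, s) ε hε
  have hnear (z : ℝ) (hz : z < s + δ) (r v : ℝ) (hr : r ∈ Icc s z) (hv : v ∈ Icc s z) :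
      ‖G₁₂ (r, v) - c‖ ≤ ε := by
    have := hball (r, v) (by
      rw [Prod.dist_eq, max_lt_iff, Real.dist_eq, Real.dist_eq, abs_lt, abs_lt]
      obtain ⟨h1, h2⟩ := hr
      obtain ⟨h3, h4⟩ := hv
      exact ⟨⟨by linarith, by linarith⟩, ⟨by linarith, by linarith⟩⟩)
    rw [dist_eq_norm] at this
    exact this.le
  filter_upwards [self_mem_nhdsWithin,
    nhdsWithin_le_nhds (Iio_mem_nhds (show s < s + δ by linarith))] with z hz hzδ
  have hz : s < z := hz
  have hlin (k : ℂ) (v : ℝ) : HasDerivAt (fun v : ℝ => k * (v : ℂ)) k v := by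
    simpa using (hasDerivAt_id v).ofReal_comp.const_mul k
  -- The mixed derivative stays within `ε` of `c` near the diagonal point. Two mean value
  -- inequalities, in `r` and then in `v`, bound the second difference after its main part `c (z -
  -- s)²` is removed.
  have step1 (v : ℝ) (hv : v ∈ Icc s z) :
      ‖G₂ (z, v) - G₂ (s, v) - c * (z - s : ℝ)‖ ≤ ε * (z - s) := by
    have := norm_image_sub_le_of_norm_deriv_le_segment' (a := s) (b := z) (C := ε)
      (f := fun r : ℝ => G₂ (r, v) - c * r) (f' := fun r => G₁₂ (r, v) - c)
      (fun r _ => ((hd₁₂ r v).sub (hlin c r)).hasDerivWithinAt)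
      (fun r hr => hnear z hzδ r v ⟨hr.1, hr.2.le⟩ hv) z (right_mem_Icc.2 hz.le)
    refine le_of_eq_of_le (congrArg norm ?_) this
    push_cast; ring
  have step2 := norm_image_sub_le_of_norm_deriv_le_segment' (a := s) (b := z) (C := ε * (z - s))
      (f := fun v : ℝ => B z v - B s v - c * (z - s : ℝ) * v)
      (f' := fun v => G₂ (z, v) - G₂ (s, v) - c * (z - s : ℝ))
      (fun v _ => (((hd₂ z v).sub (hd₂ s v)).sub (hlin _ v)).hasDerivWithinAt)
      (fun v hv => step1 v ⟨hv.1, hv.2.le⟩) z (right_mem_Icc.2 hz.le)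
  have e : B z z - B z s - B s z + B s s =
      (B z z - B s z - c * (z - s : ℝ) * z - (B z s - B s s - c * (z - s : ℝ) * s)) +
        c * ((z - s) ^ 2 : ℝ) := by
    push_cast; ring
  rw [e]
  refine (norm_add_le _ _).trans ?_
  rw [norm_mul c, Complex.norm_real, Real.norm_of_nonneg (sq_nonneg (z - s))]
  linarith [step2]

/-- A continuous curve whose squared increments are infinitesimally at most `M (z - s)²` is
Lipschitz with constant `√M`. -/
theorem norm_sub_le_sqrt_mul_of_eventually {E : Type*} [NormedAddCommGroup E] {X : ℝ → E}
    (hX : Continuous X) {M : ℝ}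
    (h : ∀ s, ∀ ε > 0, ∀ᶠ z in 𝓝[>] s, ‖X z - X s‖ ^ 2 ≤ (M + ε) * (z - s) ^ 2) (s t : ℝ) :
    ‖X t - X s‖ ≤ √M * |t - s| := by
  wlog hst : s ≤ t generalizing s t
  · rw [norm_sub_rev, abs_sub_comm]
    exact this t s (le_of_not_ge hst)
  rw [abs_of_nonneg (sub_nonneg.2 hst)]
  -- The comparison theorem needs a slope strictly above the infinitesimal one; afterwards `r`
  -- decreases to `√M`.
  have key (r : ℝ) (hr : √M < r) : ‖X t - X s‖ ≤ r * (t - s) := by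
    refine image_norm_le_of_liminf_right_slope_norm_lt_deriv_boundary (a := s) (b := t)
      (f := fun z => X z - X s) (f' := fun _ => √M) (B := fun z => r * (z - s)) (B' := fun _ => r)
      (by fun_prop) (fun x _ ρ hρ => ?_) (by simp) (by fun_prop)
      (fun x _ => ?_) (fun _ _ _ => hr) (right_mem_Icc.2 hst)
    · refine Eventually.frequently ?_
      have hρ0 : 0 < ρ := (Real.sqrt_nonneg M).trans_lt hρ
      have hMρ : M < ρ ^ 2 := (Real.sqrt_lt' hρ0).1 hρ
      filter_upwards [h x ((ρ ^ 2 - M) / 2) (by linarith), self_mem_nhdsWithin] with z hz hxz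
      have hxz : 0 < z - x := sub_pos.2 hxz
      rw [slope_def_field, div_lt_iff₀ hxz]
      have h1 : ‖X z - X x‖ < ρ * (z - x) := by
        refine lt_of_pow_lt_pow_left₀ 2 (by positivity) (hz.trans_lt ?_)
        rw [mul_pow]
        have : 0 < (z - x) ^ 2 := by positivity
        exact mul_lt_mul_of_pos_right (by linarith) this
      have h2 := norm_sub_norm_le (X z - X s) (X x - X s)
      rw [sub_sub_sub_cancel_right] at h2
      exact h2.trans_lt h1
    · have := (((hasDerivAt_id x).sub_const s).const_mul r).hasDerivWithinAt (s := Ici x)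
      simpa using this
  have hlim : Tendsto (fun r : ℝ => r * (t - s)) (𝓝[>] √M) (𝓝 (√M * (t - s))) :=
    (Continuous.tendsto (by fun_prop) _).mono_left nhdsWithin_le_nhds
  exact ge_of_tendsto hlim (by filter_upwards [self_mem_nhdsWithin] with r hr using key r hr)

section Lipschitz

variable {Ω : Type*} [MeasurableSpace Ω] {P : Measure Ω} {ξ : ℝ → Ω → ℂ}

theorem norm_toLp_sub_le (hm : ∀ t, MemLp (ξ t) 2 P)
    (hB : ContDiff ℝ 2 (fun x : ℝ × ℝ => cov P ξ x.1 x.2))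
    (hB' : BddAbove (range fun s : ℝ => ‖diagDeriv (cov P ξ) s‖)) (s t : ℝ) :
    ‖(hm t).toLp (ξ t) - (hm s).toLp (ξ s)‖ ≤
      √(⨆ s : ℝ, ‖diagDeriv (cov P ξ) s‖) * |t - s| := by
  refine norm_sub_le_sqrt_mul_of_eventually (X := fun t => (hm t).toLp (ξ t))
    (continuous_toLp hm hB.continuous)
    (fun s ε hε => ?_) s t
  filter_upwards [eventually_norm_second_difference_le hB s hε] with z hz
  rw [norm_sq_increment hm s z]
  refine (Complex.re_le_norm _).trans (hz.trans ?_)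
  gcongr
  exact le_ciSup hB' s

end Lipschitz

/-! ### Local averages -/

/-- A nonintegrable function has integral `0` by convention, so normalization already implies
integrability. -/
theorem integrableOn_weight {J : Set ℝ} {v : ℝ → ℝ} (hv1 : ∫ x in J, v x = 1) :
    IntegrableOn v J := by
  by_contra h0
  rw [integral_undef h0] at hv1
  exact zero_ne_one hv1

theorem norm_setIntegral_smul_sub_le {E : Type*} [NormedAddCommGroup E] [NormedSpace ℝ E]
    [CompleteSpace E] {X : ℝ → E} {J : Set ℝ} (hJ : MeasurableSet J) {v : ℝ → ℝ}
    (hv : ∀ x ∈ J, 0 ≤ v x) (hv1 : ∫ x in J, v x = 1)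
    (hvX : IntegrableOn (fun x => v x • X x) J) {x₀ K : ℝ}
    (hK : ∀ x ∈ J, ‖X x - X x₀‖ ≤ K) :
    ‖X x₀ - ∫ x in J, v x • X x‖ ≤ K := by
  have hvi : IntegrableOn v J := integrableOn_weight hv1
  have e1 : X x₀ - ∫ x in J, v x • X x = ∫ x in J, v x • (X x₀ - X x) := by
    simp_rw [smul_sub]
    rw [integral_sub (hvi.smul_const _) hvX, integral_smul_const, hv1, one_smul]
  rw [e1]
  have e2 : ∫ x in J, v x * K = K := by rw [integral_mul_const, hv1, one_mul]
  rw [← e2]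
  refine norm_integral_le_of_norm_le (hvi.mul_const K) ?_
  filter_upwards [ae_restrict_mem hJ] with x hx
  rw [norm_smul, Real.norm_of_nonneg (hv x hx), norm_sub_rev]
  exact mul_le_mul_of_nonneg_left (hK x hx) (hv x hx)

/-! ### The spectral representation -/

theorem integral_const_mul_complexMeasure {α : Type*} [MeasurableSpace α] (F : ComplexMeasure α)
    (c : ℂ) (g : α → ℂ) :
    F.integral (fun x => c * g x) (ContinuousLinearMap.mul ℝ ℂ) =
      c * F.integral g (ContinuousLinearMap.mul ℝ ℂ) :=
  setToFun_smul _ (fun c s x => mul_assoc c x (F s)) c g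

section Spectral

variable {Ω Λ : Type*} [MeasurableSpace Ω] [MeasurableSpace Λ] {P : Measure Ω}
  {ξ : ℝ → Ω → ℂ} {f : ℂ → Λ → ℂ} {F : ComplexMeasure (Λ × Λ)}

/-- With `T l = ∑ cᵢ f (τᵢ) l`, sesquilinearity and the covariance formula identify the squared norm
with the spectral integral of `T(λ)` times the conjugate of `T(μ)`, an integrand bounded by `K²`. -/
theorem norm_sq_sum_toLp_le (hξ : IsPiranashvili P ξ f F) {ι : Type*} (s : Finset ι) (c : ι → ℂ)
    (τ : ι → ℝ) {K : ℝ} (hK : ∀ l, ‖∑ i ∈ s, c i * f (τ i) l‖ ≤ K) :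
    ‖∑ i ∈ s, c i • (hξ.memLp (τ i)).toLp (ξ (τ i))‖ ^ 2 ≤ K ^ 2 * F.variation.real univ := by
  have : IsFiniteMeasure F.variation := ⟨hξ.finite_variation⟩
  set T : Λ → ℂ := fun l => ∑ i ∈ s, c i * f (τ i) l with hT
  have hprod (x : Λ × Λ) : T x.1 * starRingEnd ℂ (T x.2) = ∑ i ∈ s, ∑ j ∈ s,
      (c i * starRingEnd ℂ (c j)) * (f (τ i) x.1 * starRingEnd ℂ (f (τ j) x.2)) := by
    simp only [hT, map_sum, map_mul, Finset.sum_mul_sum]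
    refine Finset.sum_congr rfl fun i _ => Finset.sum_congr rfl fun j _ => by ring
  have hint (i j : ι) : F.Integrable fun x : Λ × Λ =>
      (c i * starRingEnd ℂ (c j)) * (f (τ i) x.1 * starRingEnd ℂ (f (τ j) x.2)) :=
    (hξ.integrable (τ i) (τ j)).const_mul _
  have h1 : F.integral (fun x => T x.1 * starRingEnd ℂ (T x.2)) (ContinuousLinearMap.mul ℝ ℂ) =
      ∑ i ∈ s, ∑ j ∈ s, (c i * starRingEnd ℂ (c j)) * cov P ξ (τ i) (τ j) := by
    simp_rw [hprod]
    rw [VectorMeasure.integral_finsetSum s fun i _ => integrable_finsetSum s fun j _ => hint i j]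
    refine Finset.sum_congr rfl fun i _ => ?_
    rw [VectorMeasure.integral_finsetSum s fun j _ => hint i j]
    refine Finset.sum_congr rfl fun j _ => ?_
    rw [integral_const_mul_complexMeasure, hξ.cov_eq]
  have h2 : ((‖∑ i ∈ s, c i • (hξ.memLp (τ i)).toLp (ξ (τ i))‖ ^ 2 : ℝ) : ℂ) =
      F.integral (fun x => T x.1 * starRingEnd ℂ (T x.2)) (ContinuousLinearMap.mul ℝ ℂ) := by
    have h := inner_self_eq_norm_sq_to_K (𝕜 := ℂ)
      (∑ i ∈ s, c i • (hξ.memLp (τ i)).toLp (ξ (τ i)))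
    rw [h1]
    push_cast
    refine Eq.trans h.symm ?_
    rw [sum_inner, Finset.sum_comm' (t' := s) (s' := fun _ => s) (by tauto)]
    refine Finset.sum_congr rfl fun j _ => ?_
    rw [inner_sum]
    refine Finset.sum_congr rfl fun i _ => ?_
    rw [inner_smul_left, inner_smul_right, inner_toLp]
    ring
  have h3 : ‖F.integral (fun x => T x.1 * starRingEnd ℂ (T x.2)) (ContinuousLinearMap.mul ℝ ℂ)‖ ≤
      K ^ 2 * ‖ContinuousLinearMap.mul ℝ ℂ‖ * F.variation.real univ := by
    refine VectorMeasure.norm_integral_le_of_norm_le_const (Eventually.of_forall fun x => ?_)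
    rw [norm_mul, RCLike.norm_conj, sq]
    exact mul_le_mul (hK _) (hK _) (norm_nonneg _) ((norm_nonneg _).trans (hK x.1))
  rw [← h2, Complex.norm_real, Real.norm_of_nonneg (sq_nonneg _), ContinuousLinearMap.opNorm_mul,
    mul_one] at h3
  exact h3

end Spectral

/-! ### Sums of sampling functions -/

theorem summable_dirichletLambda {q : ℝ} (hq : 1 < q) :
    Summable fun n : ℕ => 1 / (2 * (n : ℝ) + 1) ^ q := by
  have h1 : Summable fun n : ℕ => 1 / ((n + 1 : ℕ) : ℝ) ^ q :=
    (summable_nat_add_iff 1).2 (Real.summable_one_div_nat_rpow.2 hq)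
  refine Summable.of_nonneg_of_le (fun n => by positivity) (fun n => ?_) h1
  push_cast
  gcongr
  linarith [(Nat.cast_nonneg n : (0 : ℝ) ≤ n)]

theorem card_indexSet_le (w : ℝ) (N : ℕ) (t : ℝ) :
    ((indexSet w N t).card : ℝ) ≤ 2 * (N : ℝ) + 1 := by
  rw [indexSet, Int.card_Icc]
  have h1 := Int.floor_le (w * t / Real.pi + N)
  have h2 := Int.le_ceil (w * t / Real.pi - N)
  have h3 : ((⌊w * t / Real.pi + N⌋ + 1 - ⌈w * t / Real.pi - N⌉ : ℤ) : ℝ) ≤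
      ((2 * N + 1 : ℤ) : ℝ) := by
    push_cast; linarith
  have h4 : (⌊w * t / Real.pi + N⌋ + 1 - ⌈w * t / Real.pi - N⌉).toNat ≤ 2 * N + 1 := by
    have := Int.cast_le.1 h3
    omega
  exact_mod_cast h4

theorem abs_sinc_rpow_le {q w t : ℝ} (hq : 0 ≤ q) {n : ℤ} {k : ℕ}
    (hk : (k : ℝ) + 1 / 2 ≤ |w * t / Real.pi - n|) :
    |Real.sinc (w * t - n * Real.pi)| ^ q ≤
      2 ^ q * |Real.sin (w * t)| ^ q / Real.pi ^ q * (1 / (2 * (k : ℝ) + 1) ^ q) := by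
  have hpi := Real.pi_pos
  have hk0 : (0 : ℝ) ≤ k := Nat.cast_nonneg k
  have e : |w * t - n * Real.pi| = |w * t / Real.pi - n| * Real.pi := by
    rw [← abs_of_pos hpi, ← abs_mul, abs_of_pos hpi, sub_mul, div_mul_cancel₀ _ hpi.ne']
  have hle : (2 * (k : ℝ) + 1) * Real.pi / 2 ≤ |w * t - n * Real.pi| := by
    rw [e]
    nlinarith
  have hpos : 0 < (2 * (k : ℝ) + 1) * Real.pi / 2 := by positivity
  have hne : w * t - n * Real.pi ≠ 0 := abs_pos.1 (hpos.trans_le hle)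
  have hsin : |Real.sin (w * t - n * Real.pi)| = |Real.sin (w * t)| := by
    have hc : |Real.cos (n * Real.pi)| = 1 := Real.abs_cos_int_mul_pi n
    rw [Real.sin_sub, Real.sin_int_mul_pi, mul_zero, sub_zero, abs_mul, hc, mul_one]
  have h1 : |Real.sinc (w * t - n * Real.pi)| ≤
      2 * |Real.sin (w * t)| / (Real.pi * (2 * (k : ℝ) + 1)) := by
    rw [Real.sinc_of_ne_zero hne, abs_div, hsin]
    calc _ ≤ |Real.sin (w * t)| / ((2 * (k : ℝ) + 1) * Real.pi / 2) := by gcongr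
      _ = _ := by field_simp
  refine (Real.rpow_le_rpow (abs_nonneg _) h1 hq).trans_eq ?_
  rw [Real.div_rpow (by positivity) (by positivity), Real.mul_rpow (by norm_num) (abs_nonneg _),
    Real.mul_rpow hpi.le (by positivity)]
  field_simp

theorem sum_comp_le_tsum {ι : Type*} {s : Finset ι} {φ : ι → ℕ} (hφ : Set.InjOn φ s) {G : ℕ → ℝ}
    (hG : ∀ k, 0 ≤ G k) (hs : Summable G) : ∑ i ∈ s, G (φ i) ≤ ∑' k, G k := by
  rw [← Finset.sum_image (g := φ) (f := G) fun i hi j hj h => hφ hi hj h]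
  exact hs.sum_le_tsum _ fun k _ => hG k

/-- Let `m` be the integer nearest to `w t / π`. Its term is at most `1`. An integer at distance `k
+ 1` from `m` is at least `k + 1/2` from `w t / π`, so each side of `m` is dominated by the lambda
series; the two sides turn `2 ^ q` into `2 ^ (q + 1)`. -/
theorem sum_abs_sinc_rpow_le {q : ℝ} (hq : 1 < q) (w : ℝ) (N : ℕ) (t : ℝ) :
    ∑ n ∈ indexSet w N t, |Real.sinc (w * t - n * Real.pi)| ^ q ≤
      1 + 2 ^ (q + 1) * |Real.sin (w * t)| ^ q / Real.pi ^ q * dirichletLambda q := by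
  classical
  set m : ℤ := round (w * t / Real.pi) with hm
  have hround : |w * t / Real.pi - m| ≤ 1 / 2 := abs_sub_round _
  obtain ⟨hr1, hr2⟩ := abs_le.1 hround
  set I := indexSet w N t
  set K : ℝ := 2 ^ q * |Real.sin (w * t)| ^ q / Real.pi ^ q with hK
  have hK0 : 0 ≤ K := by positivity
  set G : ℕ → ℝ := fun k => K * (1 / (2 * (k : ℝ) + 1) ^ q) with hG
  have hGs : Summable G := (summable_dirichletLambda hq).mul_left K
  have hG0 (k : ℕ) : 0 ≤ G k := by positivity
  have hGt : ∑' k, G k = K * dirichletLambda q := tsum_mul_left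
  set g : ℤ → ℝ := fun n => |Real.sinc (w * t - n * Real.pi)| ^ q with hg
  have hlow : ∑ n ∈ I with n < m, g n ≤ K * dirichletLambda q := by
    rw [← hGt]
    refine le_trans (Finset.sum_le_sum fun n hn => ?_)
      (sum_comp_le_tsum (φ := fun n : ℤ => (m - n - 1).toNat) (fun i hi j hj h => ?_) hG0 hGs)
    · have hn' : n < m := (Finset.mem_filter.1 hn).2
      refine abs_sinc_rpow_le (by linarith) ?_
      have h1 : (((m - n - 1).toNat : ℤ) : ℝ) = ((m - n - 1 : ℤ) : ℝ) := by
        rw [Int.toNat_of_nonneg (by omega)]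
      push_cast at h1
      rw [h1]
      refine le_trans ?_ (le_abs_self _)
      linarith
    · have hi' : i < m := (Finset.mem_filter.1 hi).2
      have hj' : j < m := (Finset.mem_filter.1 hj).2
      simp only at h
      omega
  have hhigh : ∑ n ∈ I with m < n, g n ≤ K * dirichletLambda q := by
    rw [← hGt]
    refine le_trans (Finset.sum_le_sum fun n hn => ?_)
      (sum_comp_le_tsum (φ := fun n : ℤ => (n - m - 1).toNat) (fun i hi j hj h => ?_) hG0 hGs)
    · have hn' : m < n := (Finset.mem_filter.1 hn).2
      refine abs_sinc_rpow_le (by linarith) ?_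
      have h1 : (((n - m - 1).toNat : ℤ) : ℝ) = ((n - m - 1 : ℤ) : ℝ) := by
        rw [Int.toNat_of_nonneg (by omega)]
      push_cast at h1
      rw [h1]
      refine le_trans ?_ (neg_le_abs _)
      linarith
    · have hi' : m < i := (Finset.mem_filter.1 hi).2
      have hj' : m < j := (Finset.mem_filter.1 hj).2
      simp only at h
      omega
  have hmid : ∑ n ∈ I with n = m, g n ≤ 1 := by
    have hg1 : g m ≤ 1 := Real.rpow_le_one (abs_nonneg _) (Real.abs_sinc_le_one _) (by linarith)
    have hg0 : 0 ≤ g m := by positivity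
    rw [Finset.sum_filter, Finset.sum_ite_eq']
    split_ifs <;> linarith
  have hsplit : ∑ n ∈ I, g n =
      ∑ n ∈ I with n < m, g n + ∑ n ∈ I with m < n, g n + ∑ n ∈ I with n = m, g n := by
    simp only [Finset.sum_filter, ← Finset.sum_add_distrib]
    refine Finset.sum_congr rfl fun n _ => ?_
    rcases lt_trichotomy n m with h | h | h
    · simp [h, h.not_gt, h.ne]
    · simp [h]
    · simp [h, h.not_gt, h.ne']
  have hK2 : 2 ^ (q + 1) * |Real.sin (w * t)| ^ q / Real.pi ^ q = 2 * K := by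
    rw [Real.rpow_add_one (by norm_num), hK]; ring
  rw [hsplit, hK2]
  linarith

/-- This is Hölder's inequality against the constant `1`, whose `ℓᵖ` norm is the `p`-th root of the
cardinality, at most `2N + 1`. -/
theorem sq_sum_abs_sinc_le {p q : ℝ} (hpq : p.HolderConjugate q) (w : ℝ) (N : ℕ) (t : ℝ) :
    (∑ n ∈ indexSet w N t, |Real.sinc (w * t - n * Real.pi)|) ^ 2 ≤
      sincFactor q w t * (2 * (N : ℝ) + 1) ^ (2 / p) := by
  have hq : 1 < q := hpq.symm.lt
  have hp : 1 < p := hpq.lt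
  have h1 := Real.inner_le_Lp_mul_Lq (indexSet w N t)
    (fun _ => 1) (fun n => |Real.sinc (w * t - n * Real.pi)|) hpq
  simp only [one_mul, abs_one, Real.one_rpow, Finset.sum_const, nsmul_eq_mul, mul_one,
    abs_abs] at h1
  have hR := sum_abs_sinc_rpow_le hq w N t
  have hS0 : 0 ≤ ∑ n ∈ indexSet w N t, |Real.sinc (w * t - n * Real.pi)| ^ q :=
    Finset.sum_nonneg fun n _ => by positivity
  set R := 1 + 2 ^ (q + 1) * |Real.sin (w * t)| ^ q / Real.pi ^ q * dirichletLambda q with hRdef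
  have hR0 : 0 ≤ R := hS0.trans hR
  have h2 : ∑ n ∈ indexSet w N t, |Real.sinc (w * t - n * Real.pi)| ≤
      (2 * (N : ℝ) + 1) ^ (1 / p) * R ^ (1 / q) := by
    refine h1.trans ?_
    gcongr
    exact card_indexSet_le w N t
  have h3 := pow_le_pow_left₀ (Finset.sum_nonneg fun n _ => abs_nonneg _) h2 2
  refine h3.trans_eq ?_
  rw [mul_pow, ← Real.rpow_mul_natCast (by positivity), ← Real.rpow_mul_natCast hR0, sincFactor,
    ← hRdef, mul_comm]
  push_cast
  ring_nf

/-! ### Convergence -/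

/-- By Tonelli the series of squared pointwise errors has finite expectation. It therefore converges
almost surely and its terms tend to zero. -/
theorem ae_tendsto_of_summable_norm_sq {Ω : Type*} [MeasurableSpace Ω] {P : Measure Ω}
    {Z : ℕ → Lp ℂ 2 P} {X : Lp ℂ 2 P} (h : Summable fun N => ‖X - Z N‖ ^ 2) :
    ∀ᵐ ω ∂P, Tendsto (fun N => Z N ω) atTop (𝓝 (X ω)) := by
  have hlint (N : ℕ) : ∫⁻ ω, ENNReal.ofReal (‖(X - Z N : Lp ℂ 2 P) ω‖ ^ 2) ∂P =
      ENNReal.ofReal (‖X - Z N‖ ^ 2) := by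
    rw [norm_sq_Lp_eq_integral, ofReal_integral_eq_lintegral_ofReal]
    · exact (memLp_two_iff_integrable_sq_norm (Lp.memLp _).1).1 (Lp.memLp _)
    · exact Eventually.of_forall fun _ => sq_nonneg _
  have hmeas (N : ℕ) : AEMeasurable (fun ω => ENNReal.ofReal (‖(X - Z N : Lp ℂ 2 P) ω‖ ^ 2)) P :=
    (((Lp.aestronglyMeasurable _).norm.aemeasurable).pow_const 2).ennreal_ofReal
  have hfin : ∫⁻ ω, ∑' N, ENNReal.ofReal (‖(X - Z N : Lp ℂ 2 P) ω‖ ^ 2) ∂P ≠ ⊤ := by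
    rw [lintegral_tsum hmeas]
    simp_rw [hlint]
    exact h.tsum_ofReal_ne_top
  have hae := ae_lt_top' (AEMeasurable.tsum hmeas) hfin
  have hcoe : ∀ᵐ ω ∂P, ∀ N, (X - Z N : Lp ℂ 2 P) ω = X ω - Z N ω :=
    ae_all_iff.2 fun N => Lp.coeFn_sub X (Z N)
  filter_upwards [hae, hcoe] with ω h1 h2
  have h3 := ENNReal.tendsto_atTop_zero_of_tsum_ne_top h1.ne
  have h4 := (ENNReal.continuousAt_toReal ENNReal.zero_ne_top).tendsto.comp h3
  have h5 : Tendsto (fun N => ‖X ω - Z N ω‖ ^ 2) atTop (𝓝 0) := by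
    refine h4.congr fun N => ?_
    rw [Function.comp_apply, ENNReal.toReal_ofReal (sq_nonneg _), h2]
  have h6 := (Real.continuous_sqrt.tendsto 0).comp h5
  rw [Real.sqrt_zero] at h6
  refine tendsto_iff_norm_sub_tendsto_zero.2 (h6.congr fun N => ?_)
  rw [Function.comp_apply, Real.sqrt_sq (norm_nonneg _), norm_sub_rev]

theorem isBigO_two_mul_add_one_rpow {r : ℝ} (hr : 0 ≤ r) :
    (fun N : ℕ => (2 * (N : ℝ) + 1) ^ r) =O[atTop] fun N : ℕ => (N : ℝ) ^ r := by
  refine IsBigO.of_bound (3 ^ r) ?_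
  filter_upwards [eventually_ge_atTop 1] with N hN
  have hN' : (1 : ℝ) ≤ N := by exact_mod_cast hN
  rw [Real.norm_of_nonneg (by positivity), Real.norm_of_nonneg (by positivity),
    ← Real.mul_rpow (by norm_num) (by linarith)]
  gcongr
  linarith

theorem tendsto_sq_mul_rpow_zero {σ : ℕ → ℝ} {p : ℝ} (hp : 0 < p)
    (h : σ =o[atTop] fun N : ℕ => (N : ℝ) ^ (-(1 / p))) :
    Tendsto (fun N : ℕ => σ N ^ 2 * (2 * (N : ℝ) + 1) ^ (2 / p)) atTop (𝓝 0) := by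
  have h1 := (h.pow (n := 2) (by norm_num)).mul_isBigO
    (isBigO_two_mul_add_one_rpow (r := 2 / p) (by positivity))
  refine (isLittleO_one_iff ℝ).1 (h1.congr' EventuallyEq.rfl ?_)
  filter_upwards [eventually_gt_atTop 0] with N hN
  have hN' : (0 : ℝ) < N := by exact_mod_cast hN
  rw [← Real.rpow_mul_natCast hN'.le, ← Real.rpow_add hN']
  have : -(1 / p) * (2 : ℕ) + 2 / p = 0 := by push_cast; ring
  rw [this, Real.rpow_zero]

theorem summable_sq_mul_rpow {σ : ℕ → ℝ} {p ε : ℝ} (hp : 0 < p) (hε : 0 < ε)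
    (h : σ =O[atTop] fun N : ℕ => (N : ℝ) ^ (-(1 / 2) - 1 / p - ε)) :
    Summable fun N : ℕ => σ N ^ 2 * (2 * (N : ℝ) + 1) ^ (2 / p) := by
  have hs : Summable fun N : ℕ => (N : ℝ) ^ (-1 - 2 * ε) :=
    Real.summable_nat_rpow.2 (by linarith)
  refine summable_of_isBigO_nat hs ?_
  have h1 := (h.pow 2).mul (isBigO_two_mul_add_one_rpow (r := 2 / p) (by positivity))
  refine h1.congr' EventuallyEq.rfl ?_
  filter_upwards [eventually_gt_atTop 0] with N hN
  have hN' : (0 : ℝ) < N := by exact_mod_cast hN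
  rw [← Real.rpow_mul_natCast hN'.le, ← Real.rpow_add hN']
  congr 1
  push_cast; ring

/-! ### The mean square error of average sampling -/

section Error

variable {Ω Λ : Type*} [MeasurableSpace Ω] [MeasurableSpace Λ] {P : Measure Ω}
  {ξ : ℝ → Ω → ℂ} {f : ℂ → Λ → ℂ} {F : ComplexMeasure (Λ × Λ)}

/-- The truncated sampling series with point values instead of local averages. -/
def samplingSum (hm : ∀ t, MemLp (ξ t) 2 P) (w : ℝ) (N : ℕ) (t : ℝ) : Lp ℂ 2 P :=
  ∑ n ∈ indexSet w N t, Real.sinc (w * t - n * Real.pi) •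
    (hm (n * Real.pi / w)).toLp (ξ (n * Real.pi / w))

theorem norm_kernel_sub_sum_sinc_le (hξ : IsPiranashvili P ξ f F)
    (hf : BddAbove (range fun x : ℝ × Λ => ‖f (x.1 : ℂ) x.2‖)) {w : ℝ}
    (hw : expType f < ENNReal.ofReal w) {N : ℕ} (hN : 1 ≤ N) (t : ℝ) (l : Λ) :
    ‖f t l - ∑ n ∈ indexSet w N t, (Real.sinc (w * t - n * Real.pi) : ℂ) *
      f ((n * Real.pi / w : ℝ) : ℂ) l‖ ≤ truncFactor f w t / N := by
  have htop : expType f ≠ ⊤ := (hw.trans ENNReal.ofReal_lt_top).ne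
  have hw' : (expType f).toReal < w := (ENNReal.lt_ofReal_iff_toReal_lt htop).1 hw
  have hγ : 0 ≤ (expType f).toReal := ENNReal.toReal_nonneg
  have hL : 0 ≤ kernelSup f := Real.iSup_nonneg fun _ => norm_nonneg _
  have hbd : ∀ z, ‖f z l‖ ≤ kernelSup f * Real.exp ((expType f).toReal * |z.im|) :=
    norm_le_exp_type (hξ.entire l) htop
      (le_iSup (fun l => limsup
        (fun n : ℕ => ‖iteratedDeriv n (fun z => f z l) 0‖ₑ ^ (1 / (n : ℝ))) atTop) l)
      fun x => le_ciSup hf (x, l)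
  refine (norm_sub_sum_sinc_le (hξ.entire l) hγ hw' hL hbd hN t).trans ?_
  have hpi := Real.pi_pos
  have hN0 : (0 : ℝ) < N := by exact_mod_cast hN
  have hδ : 0 < w - (expType f).toReal := sub_pos.2 hw'
  have hw0 : 0 ≤ w := hγ.trans hw'.le
  have he : 0 < 1 - Real.exp (-Real.pi) :=
    sub_pos.2 (Real.exp_lt_one_iff.2 (neg_lt_zero.2 hpi))
  -- The residue estimate yields the factor `2 / π`, which is smaller than the `1 / (1 - exp(-π))`
  -- in `truncFactor`.
  have hconst : 2 / Real.pi ≤ 1 / (1 - Real.exp (-Real.pi)) := by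
    rw [div_le_div_iff₀ hpi he]
    linarith [Real.pi_gt_three, Real.exp_pos (-Real.pi)]
  set A : ℝ := 4 * kernelSup f * w * |Real.sin (w * t)| /
    (Real.pi * (w - (expType f).toReal) * N) with hA
  have hA0 : 0 ≤ A := by positivity
  have e1 : 8 * kernelSup f * w * |Real.sin (w * t)| /
      (Real.pi ^ 2 * (w - (expType f).toReal) * N) = A * (2 / Real.pi) := by
    rw [hA]; field_simp; ring
  have e2 : truncFactor f w t / N = A * (1 / (1 - Real.exp (-Real.pi))) := by
    rw [hA, truncFactor]; field_simp
  rw [e1, e2]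
  exact mul_le_mul_of_nonneg_left hconst hA0

theorem norm_sq_sub_samplingSum_le (hξ : IsPiranashvili P ξ f F)
    (hf : BddAbove (range fun x : ℝ × Λ => ‖f (x.1 : ℂ) x.2‖)) {w : ℝ}
    (hw : expType f < ENNReal.ofReal w) {N : ℕ} (hN : 1 ≤ N) (t : ℝ) :
    ‖(hξ.memLp t).toLp (ξ t) - samplingSum hξ.memLp w N t‖ ^ 2 ≤
      (truncFactor f w t / N) ^ 2 * F.variation.real univ := by
  -- The extra index `none` carries the point `t` with coefficient `1`, so the truncation error
  -- becomes a single linear combination of values of `ξ`.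
  have h := norm_sq_sum_toLp_le hξ (Finset.insertNone (indexSet w N t))
    (fun i => i.elim (1 : ℂ) fun n => -(Real.sinc (w * t - n * Real.pi) : ℂ))
    (fun i => i.elim t fun n => n * Real.pi / w) (K := truncFactor f w t / N) (fun l => by
      rw [Finset.sum_insertNone]
      simpa [sub_eq_add_neg] using norm_kernel_sub_sum_sinc_le hξ hf hw hN t l)
  have hsmul (r : ℝ) (X : Lp ℂ 2 P) : (r : ℂ) • X = r • X := algebraMap_smul ℂ r X
  rw [Finset.sum_insertNone] at h
  simpa only [Option.elim, one_smul, neg_smul, hsmul, Finset.sum_neg_distrib, ← sub_eq_add_neg,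
    samplingSum] using h

theorem integrableOn_weight_smul_toLp (hm : ∀ t, MemLp (ξ t) 2 P)
    (hB : Continuous fun x : ℝ × ℝ => cov P ξ x.1 x.2) {w : ℝ} {n : ℤ} {a b : ℝ} {v : ℝ → ℝ}
    (hv : ∫ x in avgInterval w n a b, v x = 1) :
    IntegrableOn (fun x => v x • (hm x).toLp (ξ x)) (avgInterval w n a b) :=
  (integrableOn_weight hv).smul_continuousOn (continuous_toLp hm hB).continuousOn isCompact_Icc

theorem norm_samplingSum_sub_averageSum_le (hm : ∀ t, MemLp (ξ t) 2 P)
    (hB : ContDiff ℝ 2 (fun x : ℝ × ℝ => cov P ξ x.1 x.2))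
    (hB' : BddAbove (range fun s : ℝ => ‖diagDeriv (cov P ξ) s‖)) {w : ℝ} {N : ℕ}
    {a b : ℝ → ℤ → ℝ} {u : ℝ → ℤ → ℝ → ℝ} (hu : IsAveragingScheme w N a b u) (t : ℝ) :
    ‖samplingSum hm w N t - averageSum hm w N a b u t‖ ≤
      (∑ n ∈ indexSet w N t, |Real.sinc (w * t - n * Real.pi)|) *
        (√(⨆ s : ℝ, ‖diagDeriv (cov P ξ) s‖) * sigma w N a b) := by
  rw [samplingSum, averageSum, ← Finset.sum_sub_distrib, Finset.sum_mul]
  refine norm_sum_le_of_le _ fun n hn => ?_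
  rw [← smul_sub, norm_smul, Real.norm_eq_abs]
  refine mul_le_mul_of_nonneg_left ?_ (abs_nonneg _)
  have hσ : max (a t n) (b t n) ≤ sigma w N a b := le_csSup hu.bounded ⟨t, n, hn, rfl⟩
  have hn1 := hu.weight_normalized t n hn
  refine norm_setIntegral_smul_sub_le (X := fun x => (hm x).toLp (ξ x)) measurableSet_Icc
    (hu.weight_nonneg t n hn) hn1 (integrableOn_weight_smul_toLp hm hB.continuous hn1)
    fun x hx => ?_
  refine (norm_toLp_sub_le hm hB hB' _ _).trans ?_
  refine mul_le_mul_of_nonneg_left (le_trans ?_ hσ) (Real.sqrt_nonneg _)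
  obtain ⟨h1, h2⟩ := hx
  rw [abs_le]
  constructor <;> linarith [le_max_left (a t n) (b t n), le_max_right (a t n) (b t n)]

theorem meanSquareError_averageSum_le (hξ : IsPiranashvili P ξ f F)
    (hf : BddAbove (range fun x : ℝ × Λ => ‖f (x.1 : ℂ) x.2‖)) {w : ℝ}
    (hw : expType f < ENNReal.ofReal w)
    (hB : ContDiff ℝ 2 (fun x : ℝ × ℝ => cov P ξ x.1 x.2))
    (hB' : BddAbove (range fun s : ℝ => ‖diagDeriv (cov P ξ) s‖)) {p q : ℝ}
    (hpq : p.HolderConjugate q) {N : ℕ} (hN : 1 ≤ N) {a b : ℝ → ℤ → ℝ} {u : ℝ → ℤ → ℝ → ℝ}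
    (hu : IsAveragingScheme w N a b u) (t : ℝ) :
    meanSquareError P (ξ t) (averageSum hξ.memLp w N a b u t) ≤
      2 * truncFactor f w t ^ 2 / (N : ℝ) ^ 2 * F.variation.real univ +
        2 * sigma w N a b ^ 2 * sincFactor q w t * (⨆ s : ℝ, ‖diagDeriv (cov P ξ) s‖) *
          (2 * (N : ℝ) + 1) ^ (2 / p) := by
  set M := ⨆ s : ℝ, ‖diagDeriv (cov P ξ) s‖ with hM
  have hM0 : 0 ≤ M := Real.iSup_nonneg fun _ => norm_nonneg _
  rw [meanSquareError_eq hξ.memLp]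
  set x := (hξ.memLp t).toLp (ξ t)
  set y := samplingSum hξ.memLp w N t
  set z := averageSum hξ.memLp w N a b u t
  have h1 : ‖x - y‖ ^ 2 ≤ (truncFactor f w t / N) ^ 2 * F.variation.real univ :=
    norm_sq_sub_samplingSum_le hξ hf hw hN t
  have h2 : ‖y - z‖ ^ 2 ≤
      (sincFactor q w t * (2 * (N : ℝ) + 1) ^ (2 / p)) * (M * sigma w N a b ^ 2) := by
    refine (pow_le_pow_left₀ (norm_nonneg _)
      (norm_samplingSum_sub_averageSum_le hξ.memLp hB hB' hu t) 2).trans ?_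
    rw [mul_pow, mul_pow, Real.sq_sqrt hM0]
    exact mul_le_mul_of_nonneg_right (sq_sum_abs_sinc_le hpq w N t) (by positivity)
  have h3 : ‖x - z‖ ^ 2 ≤ 2 * ‖x - y‖ ^ 2 + 2 * ‖y - z‖ ^ 2 := by
    have h4 := norm_sub_le_norm_sub_add_norm_sub x y z
    have h5 := pow_le_pow_left₀ (norm_nonneg _) h4 2
    nlinarith [sq_nonneg (‖x - y‖ - ‖y - z‖)]
  have e : 2 * truncFactor f w t ^ 2 / (N : ℝ) ^ 2 * F.variation.real univ =
      2 * ((truncFactor f w t / N) ^ 2 * F.variation.real univ) := by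
    rw [div_pow]; ring
  rw [e]
  linarith

end Error

end AverageSampling

end

/-! ### The main theorem: error bound and convergence -/

theorem theorem3 {Ω Λ : Type*} [MeasurableSpace Ω] [MeasurableSpace Λ]
    (P : Measure Ω) [IsProbabilityMeasure P]
    (ξ : ℝ → Ω → ℂ) (f : ℂ → Λ → ℂ) (F : ComplexMeasure (Λ × Λ))
    (hξ : AverageSampling.IsPiranashvili P ξ f F)
    (hf : BddAbove (range fun x : ℝ × Λ => ‖f (x.1 : ℂ) x.2‖))
    (w : ℝ) (hw : AverageSampling.expType f < ENNReal.ofReal w)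
    (hB : ContDiff ℝ 2 (fun x : ℝ × ℝ => AverageSampling.cov P ξ x.1 x.2))
    (hB' : BddAbove (range fun s : ℝ => ‖AverageSampling.diagDeriv (AverageSampling.cov P ξ) s‖))
    (p q : ℝ) (hp : 1 < p) (hpq : 1 / p + 1 / q = 1)
    (a b : ℕ → ℝ → ℤ → ℝ) (u : ℕ → ℝ → ℤ → ℝ → ℝ)
    (hu : ∀ N : ℕ, 1 ≤ N → AverageSampling.IsAveragingScheme w N (a N) (b N) (u N)) :
    -- the local averages exist as mean square integrals
    (∀ N : ℕ, 1 ≤ N → ∀ t : ℝ, ∀ n ∈ AverageSampling.indexSet w N t,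
      IntegrableOn (fun x => u N t n x • (hξ.memLp x).toLp (ξ x))
        (AverageSampling.avgInterval w n (a N t n) (b N t n))) ∧
    -- the mean square error bound
    (∀ N : ℕ, 1 ≤ N → ∀ t : ℝ,
      AverageSampling.meanSquareError P (ξ t)
          (AverageSampling.averageSum hξ.memLp w N (a N) (b N) (u N) t) ≤
        2 * AverageSampling.truncFactor f w t ^ 2 / (N : ℝ) ^ 2 * F.variation.real univ +
        2 * AverageSampling.sigma w N (a N) (b N) ^ 2 * AverageSampling.sincFactor q w t *
          (⨆ s : ℝ, ‖AverageSampling.diagDeriv (AverageSampling.cov P ξ) s‖) *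
          (2 * (N : ℝ) + 1) ^ (2 / p)) ∧
    -- convergence in mean square
    ((fun N : ℕ => AverageSampling.sigma w N (a N) (b N)) =o[atTop]
        (fun N : ℕ => (N : ℝ) ^ (-(1 / p))) →
      ∀ t : ℝ, Tendsto (fun N : ℕ => AverageSampling.meanSquareError P (ξ t)
        (AverageSampling.averageSum hξ.memLp w N (a N) (b N) (u N) t)) atTop (nhds 0)) ∧
    -- almost sure convergence
    (∀ ε : ℝ, 0 < ε →
      (fun N : ℕ => AverageSampling.sigma w N (a N) (b N)) =O[atTop]
        (fun N : ℕ => (N : ℝ) ^ (-(1 / 2) - 1 / p - ε)) →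
      ∀ t : ℝ, ∀ᵐ ω ∂P, Tendsto (fun N : ℕ =>
        AverageSampling.averageSum hξ.memLp w N (a N) (b N) (u N) t ω) atTop
          (nhds (ξ t ω))) := by
  have hpq' : p.HolderConjugate q :=
    Real.holderConjugate_iff.2 ⟨hp, by simpa only [one_div] using hpq⟩
  have hp0 : 0 < p := by linarith
  have hbound : ∀ N : ℕ, 1 ≤ N → ∀ t : ℝ, _ := fun N hN t =>
    AverageSampling.meanSquareError_averageSum_le hξ hf hw hB hB' hpq' hN (hu N hN) t
  have hN2 : Summable fun N : ℕ => 1 / (N : ℝ) ^ 2 :=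
    Real.summable_one_div_nat_pow.2 one_lt_two
  set V := F.variation.real univ
  set M := ⨆ s : ℝ, ‖AverageSampling.diagDeriv (AverageSampling.cov P ξ) s‖
  set σ : ℕ → ℝ := fun N => AverageSampling.sigma w N (a N) (b N)
  have hmajorant (t : ℝ) (N : ℕ) :
      2 * AverageSampling.truncFactor f w t ^ 2 / (N : ℝ) ^ 2 * V +
        2 * σ N ^ 2 * AverageSampling.sincFactor q w t * M * (2 * (N : ℝ) + 1) ^ (2 / p) =
      2 * AverageSampling.truncFactor f w t ^ 2 * V * (1 / (N : ℝ) ^ 2) +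
        2 * AverageSampling.sincFactor q w t * M *
          (σ N ^ 2 * (2 * (N : ℝ) + 1) ^ (2 / p)) := by ring
  refine ⟨fun N hN t n hn => AverageSampling.integrableOn_weight_smul_toLp hξ.memLp hB.continuous
      ((hu N hN).weight_normalized t n hn), hbound, fun hσ t => ?_, fun ε hε hσ t => ?_⟩
  · have h1 := (hN2.tendsto_atTop_zero.const_mul
      (2 * AverageSampling.truncFactor f w t ^ 2 * V)).add
      ((AverageSampling.tendsto_sq_mul_rpow_zero hp0 hσ).const_mul
        (2 * AverageSampling.sincFactor q w t * M))
    rw [mul_zero, mul_zero, add_zero] at h1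
    refine squeeze_zero' (Eventually.of_forall fun N => integral_nonneg fun ω => sq_nonneg _) ?_ h1
    filter_upwards [eventually_ge_atTop 1] with N hN
    exact (hbound N hN t).trans_eq (hmajorant t N)
  · have h1 := (hN2.mul_left (2 * AverageSampling.truncFactor f w t ^ 2 * V)).add
      ((AverageSampling.summable_sq_mul_rpow hp0 hε hσ).mul_left
        (2 * AverageSampling.sincFactor q w t * M))
    have h2 : Summable fun N => ‖(hξ.memLp t).toLp (ξ t) -
        AverageSampling.averageSum hξ.memLp w N (a N) (b N) (u N) t‖ ^ 2 := by
      -- The error bound is available only for `N ≥ 1`, so the comparison is made eventually rather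
      -- than termwise.
      refine summable_of_isBigO_nat h1 (IsBigO.of_bound 1 ?_)
      filter_upwards [eventually_ge_atTop 1] with N hN
      rw [one_mul, Real.norm_of_nonneg (sq_nonneg _), ← AverageSampling.meanSquareError_eq]
      exact ((hbound N hN t).trans_eq (hmajorant t N)).trans (le_abs_self _)
    filter_upwards [AverageSampling.ae_tendsto_of_summable_norm_sq h2,
      (hξ.memLp t).coeFn_toLp] with ω h3 h4
    rwa [h4] at h3
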